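/- **Setting.** Let $L$ be a partially ordered directed set and let $(\mathcal A_\gamma, p_{\gamma\gamma'})_{\gamma\le\gamma'\in L}$ be a projective family of compact (Hausdorff) smooth manifolds: each $\mathcal A_\gamma$ is a compact smooth manifold of some dimension $d_\gamma$, and for $\gamma'\ge\gamma$ there is a smooth surjective projection $p_{\gamma\gamma'}:\mathcal A_{\gamma'}\to\mathcal A_\gamma$, with $p_{\gamma\gamma'}\circ p_{\gamma'\gamma''}=p_{\gamma\gamma''}$ for $\gamma''\ge\gamma'\ge\gamma$. (The space of generalized connections of a principal bundle with compact connected structure group $G$, with $L$ the set of graphs in the base manifold and $\mathcal A_\gamma\cong G^{E(\gamma)}$, $E(\gamma)$ being the number of edges of $\gamma$, is the main example.) Let $\overline{\mathcal A}$ be its projective limit, with projections $p_\gamma:\overline{\mathcal A}\to\mathcal A_\gamma$. * $\mathrm{Cyl}^n(\overline{\mathcal A})$ is the set of cylindrical functions $F=f\circ p_\gamma$ on $\overline{\mathcal A}$ with $\gamma\in L$ and $f:\mathcal A_\gamma\to\mathbb C$ of class $C^n$. * A smooth volume form $\mu$ on $\overline{\mathcal A}$ is a family $(\mu_\gamma)_{\gamma\in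 L}$ of smooth nowhere vanishing $d_\gamma$-forms on $\mathcal A_\gamma$, where $\mathcal A_\gamma$ is oriented so that $\mu_\gamma$ is positive, such that $\int_{\mathcal A_\gamma} f\,\mu_\gamma=\int_{\mathcal A_{\gamma'}}(f\circ p_{\gamma\gamma'})\,\mu_{\gamma'}$ for all $\gamma'\ge\gamma$ and all continuous $f$ on $\mathcal A_\gamma$. It defines a regular Borel measure on $\overline{\mathcal A}$, also denoted $\mu$, with $\int_{\overline{\mathcal A}} (f\circ p_\gamma)\,\mu=\int_{\mathcal A_\gamma}f\,\mu_\gamma$ for all continuous $f$ on $\mathcal A_\gamma$. * A smooth vector field $X$ on $\overline{\mathcal A}$ based at $\gamma_0\in L$ is a family $(X_\gamma)_{\gamma\ge\gamma_0}$ of smooth vector fields on $\mathcal A_\gamma$ with $(p_{\gamma\gamma'})_*X_{\gamma'}=X_\gamma$ for $\gamma'\ge\gamma\ge\gamma_0$. It acts on $\mathrm{Cyl}^1(\overline{\mathcal A})$ by $X(f\circ p_\gamma)=X_\gamma(f)\circ p_\gamma$ for $\gamma\ge\gamma_0$. The commutator $[X,Y]$ of vector fields based at $\gamma_1$ and $\gamma_2$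 is the vector field $([X_\gamma,Y_\gamma])_{\gamma\ge\gamma_3}$, where $\gamma_3$ is any label with $\gamma_3\ge\gamma_1,\gamma_2$. * With $\mathrm{div}_{\mu_\gamma}X_\gamma$ defined by $L_{X_\gamma}\mu_\gamma=(\mathrm{div}_{\mu_\gamma}X_\gamma)\,\mu_\gamma$, the vector field $X$ is compatible with $\mu$ if $(\mathrm{div}_{\mu_\gamma}X_\gamma)\circ p_{\gamma\gamma'}=\mathrm{div}_{\mu_{\gamma'}}X_{\gamma'}$ for all $\gamma'\ge\gamma\ge\gamma_0$; then $\mathrm{div}_\mu X:=(\mathrm{div}_{\mu_\gamma}X_\gamma)\circ p_\gamma$, which does not depend on $\gamma\ge\gamma_0$. **Proposition (divergence properties).** Let $\mu$ be a smooth volume form and $X$ a smooth vector field on $\overline{\mathcal A}$ compatible with $\mu$. (i) For all $f,g\in\mathrm{Cyl}^1(\overline{\mathcal A})$, $$\int_{\overline{\mathcal A}} f\,X(g)\,\mu=-\int_{\overline{\mathcal A}}\bigl(X(f)+(\mathrm{div}_\mu X)\,f\bigr)\,g\,\mu .$$ (ii) If $Y$ is another smooth vector field on $\overline{\mathcal A}$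 compatible with $\mu$, then $[X,Y]$ is compatible with $\mu$ and $$\mathrm{div}_\mu[X,Y]=X(\mathrm{div}_\mu Y)-Y(\mathrm{div}_\mu X).$$ -/

import Mathlib

open MeasureTheory Set Topology VectorField
open scoped Manifold ContDiff

noncomputable section

namespace ProjGeom

/-! ### Volume forms, Lie derivative and divergence on a finite-dimensional manifold -/

section Manifold

/-- The standard `d`-dimensional real model space. -/
abbrev Model (d : ℕ) : Type := EuclideanSpace ℝ (Fin d)

/-- The standard basis of the model space. -/
def stdBasis (d : ℕ) : Fin d → Model d := fun i => EuclideanSpace.single i 1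

variable {d : ℕ} {N : Type*} [TopologicalSpace N] [ChartedSpace (Model d) N]

/-- The coordinate expression, in the preferred chart around `x₀`, of a `d`-form on a
`d`-dimensional manifold: the pull-back of the form by the inverse of the chart. -/
def formInChart (ν : ∀ x : N, TangentSpace 𝓘(ℝ, Model d) x [⋀^Fin d]→L[ℝ] ℝ) (x₀ : N)
    (y : Model d) : Model d [⋀^Fin d]→L[ℝ] ℝ :=
  (ν ((extChartAt 𝓘(ℝ, Model d) x₀).symm y)).compContinuousLinearMap
    (mfderiv 𝓘(ℝ, Model d) 𝓘(ℝ, Model d) (extChartAt 𝓘(ℝ, Model d) x₀).symm y)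

/-- The coordinate expression of a vector field in the preferred chart around `x₀`. -/
def fieldInChart (V : ∀ x : N, TangentSpace 𝓘(ℝ, Model d) x) (x₀ : N) : Model d → Model d :=
  mpullback 𝓘(ℝ, Model d) 𝓘(ℝ, Model d) (extChartAt 𝓘(ℝ, Model d) x₀).symm V

variable (d N) in
/-- A smooth volume form on a `d`-dimensional manifold `N`: a smooth nowhere vanishing `d`-form. -/
structure VolForm where
  /-- the value of the form at a point -/
  form : ∀ x : N, TangentSpace 𝓘(ℝ, Model d) x [⋀^Fin d]→L[ℝ] ℝ
  smooth : ∀ x₀ : N, ContDiffOn ℝ ∞ (formInChart form x₀) (extChartAt 𝓘(ℝ, Model d) x₀).target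
  ne_zero : ∀ x : N, form x ≠ 0

/-- For a `d`-form `η` on a vector space and an endomorphism `B`, the `d`-form
`(v₁, …, v_d) ↦ ∑ᵢ η (v₁, …, B vᵢ, …, v_d)`. -/
def derivationForm (η : Model d [⋀^Fin d]→L[ℝ] ℝ) (B : Model d →L[ℝ] Model d) :
    Model d [⋀^Fin d]→L[ℝ] ℝ where
  toContinuousMultilinearMap := ∑ i : Fin d, η.toContinuousMultilinearMap.compContinuousLinearMap
    (Function.update (fun _ => ContinuousLinearMap.id ℝ (Model d)) i B)
  map_eq_zero_of_eq' := by
    intro v i j hij hne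
    have key : ∀ k : Fin d, (fun l => (Function.update (fun _ : Fin d =>
        ContinuousLinearMap.id ℝ (Model d)) k B) l (v l)) = Function.update v k (B (v k)) := by
      intro k
      funext l
      rcases eq_or_ne l k with rfl | hl
      · simp
      · simp [Function.update_of_ne hl]
    simp only [MultilinearMap.toFun_eq_coe, ContinuousMultilinearMap.coe_coe,
      sum_apply, ContinuousMultilinearMap.compContinuousLinearMap_apply,
      key, ContinuousAlternatingMap.coe_toContinuousMultilinearMap]
    rw [← Finset.sum_subset (Finset.subset_univ {i, j})]
    · rw [Finset.sum_pair hne]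
      have h1 : Function.update v j (B (v j)) =
          Function.update v i (B (v i)) ∘ Equiv.swap i j := by
        funext l
        rcases eq_or_ne l i with rfl | hi
        · simp [Function.update_of_ne hne, Function.update_of_ne hne.symm, hij]
        · rcases eq_or_ne l j with rfl | hj
          · simp [hij]
          · simp [Function.update_of_ne hi, Function.update_of_ne hj,
              Equiv.swap_apply_of_ne_of_ne hi hj]
      have h2 := η.toAlternatingMap.map_swap (Function.update v i (B (v i))) hne
      simp only [ContinuousAlternatingMap.coe_toAlternatingMap] at h2
      rw [h1, h2]
      ring
    · intro k _ hk
      simp only [Finset.mem_insert, Finset.mem_singleton, not_or] at hk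
      apply ContinuousAlternatingMap.map_eq_zero_of_eq _ _ _ hne
      rw [Function.update_of_ne (Ne.symm hk.1), Function.update_of_ne (Ne.symm hk.2), hij]

theorem derivationForm_apply (η : Model d [⋀^Fin d]→L[ℝ] ℝ) (B : Model d →L[ℝ] Model d)
    (v : Fin d → Model d) :
    derivationForm η B v = ∑ i : Fin d, η (Function.update v i (B (v i))) := by
  change (∑ i : Fin d, η.toContinuousMultilinearMap.compContinuousLinearMap
    (Function.update (fun _ => ContinuousLinearMap.id ℝ (Model d)) i B)) v = _
  rw [sum_apply]
  refine Finset.sum_congr rfl fun k _ => ?_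
  rw [ContinuousMultilinearMap.compContinuousLinearMap_apply]
  refine congrArg η (funext fun l => ?_)
  rcases eq_or_ne l k with rfl | hl
  · simp
  · simp [Function.update_of_ne hl]

/-- The Lie derivative `L_V ν` in coordinates: for a `d`-form `η` and a vector field `W` on the
model space, `(L_W η)_y (v₁, …, v_d) = (D_W η)(v₁, …, v_d) + ∑ᵢ η_y (v₁, …, DW(vᵢ), …, v_d)`. -/
def lieDerivCoord (W : Model d → Model d) (η : Model d → Model d [⋀^Fin d]→L[ℝ] ℝ)
    (y : Model d) : Model d [⋀^Fin d]→L[ℝ] ℝ :=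
  fderiv ℝ η y (W y) + derivationForm (η y) (fderiv ℝ W y)

/-- The Lie derivative `L_V ν` of a `d`-form along a vector field on a `d`-dimensional manifold,
computed at `x` in the preferred chart around `x` and pulled back by this chart. -/
def lieDeriv (V : ∀ x : N, TangentSpace 𝓘(ℝ, Model d) x)
    (ν : ∀ x : N, TangentSpace 𝓘(ℝ, Model d) x [⋀^Fin d]→L[ℝ] ℝ) (x : N) :
    TangentSpace 𝓘(ℝ, Model d) x [⋀^Fin d]→L[ℝ] ℝ :=
  (lieDerivCoord (fieldInChart V x) (formInChart ν x)
    (extChartAt 𝓘(ℝ, Model d) x x)).compContinuousLinearMap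
    (mfderiv 𝓘(ℝ, Model d) 𝓘(ℝ, Model d) (extChartAt 𝓘(ℝ, Model d) x) x)

theorem exists_eq_smul_of_ne_zero (η ν : Model d [⋀^Fin d]→L[ℝ] ℝ) (h : ν ≠ 0) :
    ∃ c : ℝ, η = c • ν := by
  let b := (EuclideanSpace.basisFun (Fin d) ℝ).toBasis
  have hη := AlternatingMap.eq_smul_basis_det b η.toAlternatingMap
  have hν := AlternatingMap.eq_smul_basis_det b ν.toAlternatingMap
  have hb : ν b ≠ 0 := by
    intro h0
    apply h
    apply ContinuousAlternatingMap.toAlternatingMap_injective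
    rw [hν]
    simp [h0]
  refine ⟨η b / ν b, ContinuousAlternatingMap.toAlternatingMap_injective ?_⟩
  ext v
  have e1 := congrArg (fun f => f v) hη
  have e2 := congrArg (fun f => f v) hν
  simp at e1 e2
  simp [e1, e2]
  field_simp

theorem exists_divergence (ν : VolForm d N) (V : ∀ x : N, TangentSpace 𝓘(ℝ, Model d) x) :
    ∃ h : N → ℝ, ∀ x, lieDeriv V ν.form x = h x • ν.form x := by
  choose h hh using fun x => exists_eq_smul_of_ne_zero (d := d) (lieDeriv V ν.form x) (ν.form x)
    (ν.ne_zero x)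
  exact ⟨h, hh⟩

/-- The divergence `div_ν V` of a vector field with respect to a volume form: the function
with `L_V ν = (div_ν V) ν`. -/
def divergence (ν : VolForm d N) (V : ∀ x : N, TangentSpace 𝓘(ℝ, Model d) x) : N → ℝ :=
  (exists_divergence ν V).choose

theorem lieDeriv_eq (ν : VolForm d N) (V : ∀ x : N, TangentSpace 𝓘(ℝ, Model d) x) (x : N) :
    lieDeriv V ν.form x = divergence ν V x • ν.form x :=
  (exists_divergence ν V).choose_spec x

variable [IsManifold 𝓘(ℝ, Model d) ∞ N] [CompactSpace N] [T2Space N]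

variable (d N) in
/-- A smooth partition of unity subordinate to the domains of the preferred charts. -/
def chartPartition : SmoothPartitionOfUnity N 𝓘(ℝ, Model d) N univ :=
  (SmoothPartitionOfUnity.exists_isSubordinate_chartAt_source 𝓘(ℝ, Model d) N).choose

theorem chartPartition_subordinate :
    (chartPartition d N).IsSubordinate (fun x => (chartAt (Model d) x).source) :=
  (SmoothPartitionOfUnity.exists_isSubordinate_chartAt_source 𝓘(ℝ, Model d) N).choose_spec

variable [MeasurableSpace N] [BorelSpace N]

/-- The Borel measure of a volume form `ν`, for the orientation in which `ν` is positive: with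
a smooth partition of unity `(ρ_i)` subordinate to charts,
`∫ f ν = ∑ᵢ ∫ (ρ_i f)(chartᵢ⁻¹ y) |ν_i(y)(e₁, …, e_d)| dy`, where `ν_i` is the coordinate
expression of `ν` in the `i`-th chart. -/
def VolForm.measure (ν : VolForm d N) : Measure N :=
  Measure.sum fun i : N =>
    ((volume.restrict (extChartAt 𝓘(ℝ, Model d) i).target).withDensity fun y =>
      ENNReal.ofReal (chartPartition d N i ((extChartAt 𝓘(ℝ, Model d) i).symm y) *
        |formInChart ν.form i y (stdBasis d)|)).map (extChartAt 𝓘(ℝ, Model d) i).symm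

instance (ν : VolForm d N) : IsFiniteMeasure ν.measure := by
  have hfin : {i : N | (Function.support (chartPartition d N i)).Nonempty}.Finite :=
    (chartPartition d N).locallyFinite.finite_nonempty_of_compact
  have key : ∀ i : N, ∫⁻ y in (extChartAt 𝓘(ℝ, Model d) i).target,
      ENNReal.ofReal (chartPartition d N i ((extChartAt 𝓘(ℝ, Model d) i).symm y) *
        |formInChart ν.form i y (stdBasis d)|) ≠ ⊤ := by
    intro i
    have hsub : tsupport (chartPartition d N i) ⊆ (extChartAt 𝓘(ℝ, Model d) i).source := by
      rw [extChartAt_source]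
      exact chartPartition_subordinate i
    let K := extChartAt 𝓘(ℝ, Model d) i '' tsupport (chartPartition d N i)
    have hK : IsCompact K := (isClosed_tsupport _).isCompact.image_of_continuousOn
      ((continuousOn_extChartAt i).mono hsub)
    have hKT : K ⊆ (extChartAt 𝓘(ℝ, Model d) i).target := by
      rintro _ ⟨x, hx, rfl⟩
      exact (extChartAt 𝓘(ℝ, Model d) i).map_source (hsub hx)
    obtain ⟨C, hC⟩ := hK.exists_bound_of_continuousOn ((ν.smooth i).continuousOn.mono hKT)
    have hle : ∀ y ∈ (extChartAt 𝓘(ℝ, Model d) i).target,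
        ENNReal.ofReal (chartPartition d N i ((extChartAt 𝓘(ℝ, Model d) i).symm y) *
          |formInChart ν.form i y (stdBasis d)|) ≤
        K.indicator (fun _ => ENNReal.ofReal (C * ∏ j, ‖stdBasis d j‖)) y := by
      intro y hy
      by_cases hyK : y ∈ K
      · rw [indicator_of_mem hyK]
        apply ENNReal.ofReal_le_ofReal
        calc _ ≤ 1 * |formInChart ν.form i y (stdBasis d)| :=
              mul_le_mul_of_nonneg_right ((chartPartition d N).le_one i _) (abs_nonneg _)
          _ ≤ ‖formInChart ν.form i y‖ * ∏ j, ‖stdBasis d j‖ := by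
              rw [one_mul]
              exact (formInChart ν.form i y).le_opNorm _
          _ ≤ _ := mul_le_mul_of_nonneg_right (hC y hyK)
              (Finset.prod_nonneg fun _ _ => norm_nonneg _)
      · have h0 : chartPartition d N i ((extChartAt 𝓘(ℝ, Model d) i).symm y) = 0 := by
          by_contra hne
          exact hyK ⟨_, subset_tsupport _ hne, (extChartAt 𝓘(ℝ, Model d) i).right_inv hy⟩
        rw [h0, zero_mul, ENNReal.ofReal_zero]
        exact zero_le
    refine ne_of_lt (lt_of_le_of_lt
      (setLIntegral_mono' (isOpen_extChartAt_target i).measurableSet hle) ?_)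
    refine lt_of_le_of_lt (lintegral_mono' Measure.restrict_le_self le_rfl) ?_
    rw [lintegral_indicator_const hK.isClosed.measurableSet]
    exact ENNReal.mul_lt_top ENNReal.ofReal_lt_top hK.measure_lt_top
  refine ⟨?_⟩
  rw [VolForm.measure, Measure.sum_apply _ MeasurableSet.univ, tsum_eq_sum (s := hfin.toFinset)]
  · refine ENNReal.sum_lt_top.2 fun i _ => ?_
    have := isFiniteMeasure_withDensity (key i)
    exact measure_lt_top _ _
  · intro i hi
    have h0 : ∀ x, chartPartition d N i x = 0 := by
      intro x
      by_contra hne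
      exact hi (hfin.mem_toFinset.2 ⟨x, hne⟩)
    simp [h0]

end Manifold

/-! ### Lie brackets of related vector fields are related -/

theorem mlieBracket_eq_chart {d : ℕ} {N : Type*} [TopologicalSpace N] [ChartedSpace (Model d) N]
    [IsManifold 𝓘(ℝ, Model d) ∞ N] (V W : ∀ x : N, TangentSpace 𝓘(ℝ, Model d) x) (x : N) :
    mlieBracket 𝓘(ℝ, Model d) V W x = lieBracket ℝ (fieldInChart V x) (fieldInChart W x)
      (extChartAt 𝓘(ℝ, Model d) x x) := by
  have : IsManifold 𝓘(ℝ, Model d) 1 N := IsManifold.of_le (n := ∞) (by simp)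
  have h1 : (mfderiv 𝓘(ℝ, Model d) 𝓘(ℝ, Model d) (extChartAt 𝓘(ℝ, Model d) x) x) =
    ContinuousLinearMap.id ℝ (Model d) := mfderiv_extChartAt_self
  rw [← mlieBracketWithin_univ, mlieBracketWithin_apply, modelWithCornersSelf_coe, range_id,
    preimage_univ, inter_univ, mpullbackWithin_univ, mpullbackWithin_univ]
  refine (congrArg (fun T : Model d →L[ℝ] Model d => T.inverse (lieBracketWithin ℝ
    (fieldInChart V x) (fieldInChart W x) univ (extChartAt 𝓘(ℝ, Model d) x x))) h1).trans ?_
  simp only [ContinuousLinearMap.inverse_id, ContinuousLinearMap.id_apply, lieBracketWithin_univ]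

theorem differentiableAt_fieldInChart {d : ℕ} {N : Type*} [TopologicalSpace N]
    [ChartedSpace (Model d) N] [IsManifold 𝓘(ℝ, Model d) ∞ N]
    {V : ∀ x : N, TangentSpace 𝓘(ℝ, Model d) x}
    (hV : ContMDiff 𝓘(ℝ, Model d) (𝓘(ℝ, Model d).prod 𝓘(ℝ, Model d)) ∞
      (fun x => (⟨x, V x⟩ : TangentBundle 𝓘(ℝ, Model d) N))) (x : N) :
    DifferentiableAt ℝ (fieldInChart V x) (extChartAt 𝓘(ℝ, Model d) x x) := by
  have : IsManifold 𝓘(ℝ, Model d) 2 N := IsManifold.of_le (n := ∞) (by norm_cast)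
  have : IsManifold 𝓘(ℝ, Model d) 1 N := IsManifold.of_le (n := ∞) (by simp)
  have key := MDifferentiableWithinAt.differentiableWithinAt_mpullbackWithin_vectorField (s := univ)
    ((hV x).mdifferentiableAt (by simp)).mdifferentiableWithinAt
  rw [modelWithCornersSelf_coe, range_id, preimage_univ, inter_univ, mpullbackWithin_univ] at key
  exact (differentiableWithinAt_univ (𝕜 := ℝ) (f := fieldInChart V x)).1 key

theorem mlieBracket_related {d d' : ℕ} {N N' : Type*} [TopologicalSpace N]
    [ChartedSpace (Model d) N] [IsManifold 𝓘(ℝ, Model d) ∞ N] [TopologicalSpace N']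
    [ChartedSpace (Model d') N'] [IsManifold 𝓘(ℝ, Model d') ∞ N'] {f : N' → N}
    (hf : ContMDiff 𝓘(ℝ, Model d') 𝓘(ℝ, Model d) ∞ f)
    {V₁ V₂ : ∀ x : N', TangentSpace 𝓘(ℝ, Model d') x}
    {W₁ W₂ : ∀ x : N, TangentSpace 𝓘(ℝ, Model d) x}
    (hV₁ : ContMDiff 𝓘(ℝ, Model d') (𝓘(ℝ, Model d').prod 𝓘(ℝ, Model d')) ∞
      (fun x => (⟨x, V₁ x⟩ : TangentBundle 𝓘(ℝ, Model d') N')))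
    (hV₂ : ContMDiff 𝓘(ℝ, Model d') (𝓘(ℝ, Model d').prod 𝓘(ℝ, Model d')) ∞
      (fun x => (⟨x, V₂ x⟩ : TangentBundle 𝓘(ℝ, Model d') N')))
    (hW₁ : ContMDiff 𝓘(ℝ, Model d) (𝓘(ℝ, Model d).prod 𝓘(ℝ, Model d)) ∞
      (fun x => (⟨x, W₁ x⟩ : TangentBundle 𝓘(ℝ, Model d) N)))
    (hW₂ : ContMDiff 𝓘(ℝ, Model d) (𝓘(ℝ, Model d).prod 𝓘(ℝ, Model d)) ∞
      (fun x => (⟨x, W₂ x⟩ : TangentBundle 𝓘(ℝ, Model d) N)))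
    (h₁ : ∀ x, mfderiv 𝓘(ℝ, Model d') 𝓘(ℝ, Model d) f x (V₁ x) = W₁ (f x))
    (h₂ : ∀ x, mfderiv 𝓘(ℝ, Model d') 𝓘(ℝ, Model d) f x (V₂ x) = W₂ (f x)) (x : N') :
    mfderiv 𝓘(ℝ, Model d') 𝓘(ℝ, Model d) f x (mlieBracket 𝓘(ℝ, Model d') V₁ V₂ x) =
      mlieBracket 𝓘(ℝ, Model d) W₁ W₂ (f x) := by
  have : IsManifold 𝓘(ℝ, Model d) 1 N := IsManifold.of_le (n := ∞) (by simp)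
  have : IsManifold 𝓘(ℝ, Model d') 1 N' := IsManifold.of_le (n := ∞) (by simp)
  have : IsManifold 𝓘(ℝ, Model d) 2 N := IsManifold.of_le (n := ∞) (by norm_cast)
  have : IsManifold 𝓘(ℝ, Model d') 2 N' := IsManifold.of_le (n := ∞) (by norm_cast)
  rw [mlieBracket_eq_chart, mlieBracket_eq_chart]
  set φ := extChartAt 𝓘(ℝ, Model d') x with hφ
  set ψ := extChartAt 𝓘(ℝ, Model d) (f x) with hψ
  let F : Model d' → Model d := ψ ∘ f ∘ φ.symm
  have hF : ContDiffAt ℝ ∞ F (φ x) := by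
    have := (contMDiffAt_iff.1 (hf x)).2
    rwa [modelWithCornersSelf_coe, range_id, contDiffWithinAt_univ] at this
  have hx : φ.symm (φ x) = x := by simp [hφ]
  have hFx : F (φ x) = ψ (f x) := by simp [F, hx]
  -- the coordinate fields are related by `F`
  have rel : ∀ (V : ∀ x : N', TangentSpace 𝓘(ℝ, Model d') x)
      (W : ∀ x : N, TangentSpace 𝓘(ℝ, Model d) x),
      (∀ x, mfderiv 𝓘(ℝ, Model d') 𝓘(ℝ, Model d) f x (V x) = W (f x)) →
      ∀ᶠ y in 𝓝 (φ x), fderiv ℝ F y (fieldInChart V x y) =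
        fieldInChart W (f x) (F y) := by
    intro V W h
    have e1 : ∀ᶠ y in 𝓝 (φ x), y ∈ φ.target := extChartAt_target_mem_nhds x
    have e2 : ∀ᶠ y in 𝓝 (φ x), f (φ.symm y) ∈ ψ.source := by
      have c : ContinuousAt (f ∘ φ.symm) (φ x) :=
        ContinuousAt.comp (by rw [hx]; exact hf.continuous.continuousAt)
          (continuousAt_extChartAt_symm x)
      apply c
      simp only [Function.comp_apply, hx]
      exact extChartAt_source_mem_nhds (f x)
    filter_upwards [e1, e2] with y hy1 hy2
    have i1 := isInvertible_mfderivWithin_extChartAt_symm (I := 𝓘(ℝ, Model d')) hy1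
    have hy2' : ψ (f (φ.symm y)) ∈ ψ.target := ψ.map_source hy2
    have i2 := isInvertible_mfderivWithin_extChartAt_symm (I := 𝓘(ℝ, Model d)) hy2'
    have i3 := mfderivWithin_extChartAt_symm_comp_mfderiv_extChartAt' (I := 𝓘(ℝ, Model d)) hy2
    rw [modelWithCornersSelf_coe, range_id, mfderivWithin_univ] at i1 i2 i3
    have d1 : MDifferentiableAt 𝓘(ℝ, Model d') 𝓘(ℝ, Model d') φ.symm y := by
      have := mdifferentiableWithinAt_extChartAt_symm (I := 𝓘(ℝ, Model d')) hy1
      rwa [modelWithCornersSelf_coe, range_id, mdifferentiableWithinAt_univ] at this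
    have d2 : MDifferentiableAt 𝓘(ℝ, Model d') 𝓘(ℝ, Model d) f (φ.symm y) :=
      (hf _).mdifferentiableAt (by simp)
    have d3 : MDifferentiableAt 𝓘(ℝ, Model d) 𝓘(ℝ, Model d) ψ (f (φ.symm y)) :=
      mdifferentiableAt_extChartAt (by rwa [← extChartAt_source 𝓘(ℝ, Model d)])
    have k1 : mfderiv 𝓘(ℝ, Model d') 𝓘(ℝ, Model d) F y =
        (mfderiv 𝓘(ℝ, Model d) 𝓘(ℝ, Model d) ψ (f (φ.symm y))).comp
          ((mfderiv 𝓘(ℝ, Model d') 𝓘(ℝ, Model d) f (φ.symm y)).comp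
            (mfderiv 𝓘(ℝ, Model d') 𝓘(ℝ, Model d') φ.symm y)) := by
      rw [mfderiv_comp y d3 (d2.comp y d1), mfderiv_comp y d2 d1]
      rfl
    rw [mfderiv_eq_fderiv] at k1
    have k2 : mfderiv 𝓘(ℝ, Model d') 𝓘(ℝ, Model d') φ.symm y
        (fieldInChart V x y) = V (φ.symm y) := by
      rw [fieldInChart, mpullback_apply]
      exact i1.self_apply_inverse _
    have k3 : fieldInChart W (f x) (F y) =
        mfderiv 𝓘(ℝ, Model d) 𝓘(ℝ, Model d) ψ (f (φ.symm y)) (W (f (φ.symm y))) := by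
      rw [fieldInChart, mpullback_apply]
      have hl : ψ.symm (F y) = f (φ.symm y) := ψ.left_inv hy2
      have k4 : (W (ψ.symm (F y)) : Model d) = W (f (φ.symm y)) :=
        congrArg (fun p => (W p : Model d)) hl
      have k5 := congrArg (fun T : Model d →L[ℝ] Model d => T (W (f (φ.symm y)))) i3
      refine i2.inverse_apply_eq.2 ?_
      exact k4.trans k5.symm
    have k6 := congrArg (fun T : Model d' →L[ℝ] Model d =>
      T (fieldInChart V x y)) k1
    refine (k6.trans ?_).trans k3.symm
    have k7 := (congrArg (fun v => mfderiv 𝓘(ℝ, Model d') 𝓘(ℝ, Model d) f (φ.symm y) v) k2).trans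
      (h _)
    exact congrArg (fun v => mfderiv 𝓘(ℝ, Model d) 𝓘(ℝ, Model d) ψ (f (φ.symm y)) v) k7
  have r₁ := rel V₁ W₁ h₁
  have r₂ := rel V₂ W₂ h₂
  have a₁ := differentiableAt_fieldInChart hV₁ x
  have a₂ := differentiableAt_fieldInChart hV₂ x
  have b₁ := differentiableAt_fieldInChart hW₁ (f x)
  have b₂ := differentiableAt_fieldInChart hW₂ (f x)
  rw [← hψ, ← hFx] at b₁ b₂
  have dF : DifferentiableAt ℝ F (φ x) := hF.differentiableAt (by simp)
  have key := fderiv_apply_lieBracket (hF.of_le (m := 2) (by norm_cast)) (by simp) a₂ a₁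
  rw [Filter.EventuallyEq.fderiv_eq r₁, Filter.EventuallyEq.fderiv_eq r₂] at key
  have c₁ := (b₁.hasFDerivAt.comp (φ x) dF.hasFDerivAt).fderiv
  have c₂ := (b₂.hasFDerivAt.comp (φ x) dF.hasFDerivAt).fderiv
  simp only [Function.comp_def] at c₁ c₂
  rw [c₁, c₂, ContinuousLinearMap.comp_apply, ContinuousLinearMap.comp_apply, r₁.self_of_nhds,
    r₂.self_of_nhds] at key
  have t₁ : mfderiv 𝓘(ℝ, Model d') 𝓘(ℝ, Model d) f x = fderiv ℝ F (φ x) := by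
    rw [((hf x).mdifferentiableAt (by simp)).mfderiv, modelWithCornersSelf_coe, range_id,
      fderivWithin_univ]
    rfl
  rw [hFx] at key
  exact (congrArg (fun T : Model d' →L[ℝ] Model d => T (lieBracket ℝ (fieldInChart V₁ x)
    (fieldInChart V₂ x) (φ x))) t₁).trans key

/-! ### Projective families of compact manifolds -/

universe u v

/-- A projective family of compact (Hausdorff) smooth manifolds labelled by `L`: compact smooth
manifolds `space γ` and smooth surjective projections `proj : space γ' → space γ` for `γ ≤ γ'`
satisfying the cocycle condition. -/
structure ProjFamily (L : Type u) [PartialOrder L] where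
  /-- the dimensions of the members -/
  dim : L → ℕ
  /-- the members of the family -/
  space : L → Type v
  [top : ∀ γ, TopologicalSpace (space γ)]
  [charted : ∀ γ, ChartedSpace (Model (dim γ)) (space γ)]
  [manifold : ∀ γ, IsManifold 𝓘(ℝ, Model (dim γ)) ∞ (space γ)]
  [compact : ∀ γ, CompactSpace (space γ)]
  [t2 : ∀ γ, T2Space (space γ)]
  /-- the projections -/
  proj : ∀ {γ γ' : L}, γ ≤ γ' → space γ' → space γ
  proj_smooth : ∀ {γ γ' : L} (h : γ ≤ γ'),
    ContMDiff 𝓘(ℝ, Model (dim γ')) 𝓘(ℝ, Model (dim γ)) ∞ (proj h)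
  proj_surjective : ∀ {γ γ' : L} (h : γ ≤ γ'), Function.Surjective (proj h)
  proj_comp : ∀ {γ γ' γ'' : L} (h : γ ≤ γ') (h' : γ' ≤ γ'') (x : space γ''),
    proj h (proj h' x) = proj (h.trans h') x

namespace ProjFamily

attribute [instance] ProjFamily.top ProjFamily.charted ProjFamily.manifold ProjFamily.compact
  ProjFamily.t2

variable {L : Type u} [PartialOrder L] (𝓕 : ProjFamily.{u, v} L)

instance (γ : L) : MeasurableSpace (𝓕.space γ) := borel _

instance (γ : L) : BorelSpace (𝓕.space γ) := ⟨rfl⟩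

/-- The projective limit of the family, with the topology of a subspace of the product. -/
def Limit : Type (max u v) :=
  ({A | ∀ (γ γ' : L) (h : γ ≤ γ'), 𝓕.proj h (A γ') = A γ} : Set (∀ γ, 𝓕.space γ))

instance : TopologicalSpace 𝓕.Limit := instTopologicalSpaceSubtype

instance : MeasurableSpace 𝓕.Limit := borel _

instance : BorelSpace 𝓕.Limit := ⟨rfl⟩

/-- The projection from the projective limit to a member of the family. -/
def limProj (γ : L) (A : 𝓕.Limit) : 𝓕.space γ := A.1 γ

/-- A function on the projective limit is a `C^n` cylindrical function, i.e. it is (the function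
on the limit determined by) an element of `Cyl^n`, if it is the pull-back of a complex valued `C^n`
function on some member of the family. -/
def IsCyl (n : ℕ∞ω) (F : 𝓕.Limit → ℂ) : Prop :=
  ∃ (γ : L) (f : 𝓕.space γ → ℂ), ContMDiff 𝓘(ℝ, Model (𝓕.dim γ)) 𝓘(ℝ, ℂ) n f ∧
    F = f ∘ 𝓕.limProj γ

/-- A smooth volume form on the projective limit: smooth volume forms on all the members, which
are consistent in the sense that the integrals of a continuous function and of its pull-back
agree. -/
structure VolumeForm where
  /-- the volume forms on the members -/
  vol : ∀ γ, VolForm (𝓕.dim γ) (𝓕.space γ)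
  consistent : ∀ {γ γ' : L} (h : γ ≤ γ') (f : 𝓕.space γ → ℂ), Continuous f →
    ∫ x, f x ∂(vol γ).measure = ∫ x, f (𝓕.proj h x) ∂(vol γ').measure

/-- A smooth vector field on the projective limit, based at the label `γ₀`: a family
`(X_γ)_{γ ≥ γ₀}` of smooth vector fields on the members which is consistent under push-forward. -/
structure VectorField (γ₀ : L) where
  /-- the vector fields on the members -/
  field : ∀ γ, γ₀ ≤ γ → ∀ x : 𝓕.space γ, TangentSpace 𝓘(ℝ, Model (𝓕.dim γ)) x
  smooth : ∀ (γ : L) (h : γ₀ ≤ γ), ContMDiff 𝓘(ℝ, Model (𝓕.dim γ))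
    (𝓘(ℝ, Model (𝓕.dim γ)).prod 𝓘(ℝ, Model (𝓕.dim γ))) ∞
    (fun x => (⟨x, field γ h x⟩ : TangentBundle 𝓘(ℝ, Model (𝓕.dim γ)) (𝓕.space γ)))
  consistent : ∀ (γ γ' : L) (h : γ₀ ≤ γ) (h' : γ ≤ γ') (x : 𝓕.space γ'),
    mfderiv 𝓘(ℝ, Model (𝓕.dim γ')) 𝓘(ℝ, Model (𝓕.dim γ)) (𝓕.proj h') x
      (field γ' (h.trans h') x) = field γ h (𝓕.proj h' x)

variable {𝓕}

theorem proj_self (γ : L) (x : 𝓕.space γ) : 𝓕.proj le_rfl x = x := by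
  obtain ⟨y, rfl⟩ := 𝓕.proj_surjective (le_refl γ) x
  exact 𝓕.proj_comp _ _ _

theorem continuous_limProj (γ : L) : Continuous (𝓕.limProj γ) :=
  (continuous_apply γ).comp continuous_subtype_val

theorem proj_limProj {γ γ' : L} (h : γ ≤ γ') (A : 𝓕.Limit) :
    𝓕.proj h (𝓕.limProj γ' A) = 𝓕.limProj γ A := A.2 γ γ' h

instance : CompactSpace 𝓕.Limit := by
  have hC : {A : ∀ γ, 𝓕.space γ | ∀ (γ γ' : L) (h : γ ≤ γ'), 𝓕.proj h (A γ') = A γ} =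
      ⋂ (γ : L) (γ' : L) (h : γ ≤ γ'), {A | 𝓕.proj h (A γ') = A γ} := by
    ext A
    simp
  refine isCompact_iff_compactSpace.mp (IsClosed.isCompact ?_)
  rw [hC]
  refine isClosed_iInter fun γ => isClosed_iInter fun γ' => isClosed_iInter fun h => ?_
  exact isClosed_eq ((𝓕.proj_smooth h).continuous.comp (continuous_apply γ')) (continuous_apply γ)

instance : T2Space 𝓕.Limit := inferInstanceAs (T2Space (Subtype _))

theorem limProj_surjective [IsDirectedOrder L] (γ : L) : Function.Surjective (𝓕.limProj γ) := by
  intro x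
  classical
  have hne : ∀ α, Nonempty (𝓕.space α) := by
    intro α
    obtain ⟨δ, h1, h2⟩ := exists_ge_ge γ α
    obtain ⟨y, -⟩ := 𝓕.proj_surjective h1 x
    exact ⟨𝓕.proj h2 y⟩
  let C : {δ : L // γ ≤ δ} → Set (∀ α, 𝓕.space α) := fun δ =>
    {A | A γ = x ∧ ∀ (α : L) (h : α ≤ δ.1), 𝓕.proj h (A δ.1) = A α}
  have hdir : Directed (· ⊇ ·) C := by
    rintro ⟨δ₁, h₁⟩ ⟨δ₂, h₂⟩
    obtain ⟨δ, k₁, k₂⟩ := exists_ge_ge δ₁ δ₂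
    refine ⟨⟨δ, h₁.trans k₁⟩, ?_, ?_⟩
    · rintro A ⟨hA, hA'⟩
      exact ⟨hA, fun α h => by rw [← hA' δ₁ k₁, 𝓕.proj_comp, hA']⟩
    · rintro A ⟨hA, hA'⟩
      exact ⟨hA, fun α h => by rw [← hA' δ₂ k₂, 𝓕.proj_comp, hA']⟩
  have hcl : ∀ δ, IsClosed (C δ) := by
    intro δ
    have hC : C δ = {A | A γ = x} ∩
        ⋂ (α : L) (h : α ≤ δ.1), {A | 𝓕.proj h (A δ.1) = A α} := by
      ext A
      simp [C]
    rw [hC]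
    refine (isClosed_eq (continuous_apply γ) continuous_const).inter ?_
    refine isClosed_iInter fun α => isClosed_iInter fun h => ?_
    exact isClosed_eq ((𝓕.proj_smooth h).continuous.comp (continuous_apply δ.1))
      (continuous_apply α)
  have hCne : ∀ δ, (C δ).Nonempty := by
    rintro ⟨δ, h⟩
    obtain ⟨y, hy⟩ := 𝓕.proj_surjective h x
    refine ⟨fun α => if k : α ≤ δ then 𝓕.proj k y else (hne α).some, ?_, ?_⟩
    · simp [h, hy]
    · intro α k
      simp [k, proj_self]
  have : Nonempty {δ : L // γ ≤ δ} := ⟨⟨γ, le_rfl⟩⟩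
  obtain ⟨A, hA⟩ := IsCompact.nonempty_iInter_of_directed_nonempty_isCompact_isClosed C hdir hCne
    (fun δ => (hcl δ).isCompact) hcl
  rw [mem_iInter] at hA
  refine ⟨⟨A, fun α β h => ?_⟩, (hA ⟨γ, le_rfl⟩).1⟩
  obtain ⟨δ, k₁, k₂⟩ := exists_ge_ge γ β
  rw [← (hA ⟨δ, k₁⟩).2 β k₂, ← (hA ⟨δ, k₁⟩).2 α (h.trans k₂), 𝓕.proj_comp]

theorem VolumeForm.integral_le_integral [IsDirectedOrder L] (μ : 𝓕.VolumeForm) {γ γ' : L}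
    {f : 𝓕.space γ → ℝ} {f' : 𝓕.space γ' → ℝ} (hf : Continuous f) (hf' : Continuous f')
    (h : ∀ A, f (𝓕.limProj γ A) ≤ f' (𝓕.limProj γ' A)) :
    ∫ x, f x ∂(μ.vol γ).measure ≤ ∫ x, f' x ∂(μ.vol γ').measure := by
  have cons : ∀ {α β : L} (k : α ≤ β) (g : 𝓕.space α → ℝ), Continuous g →
      ∫ x, g x ∂(μ.vol α).measure = ∫ x, g (𝓕.proj k x) ∂(μ.vol β).measure := by
    intro α β k g hg
    have := μ.consistent k (fun x => (g x : ℂ)) (Complex.continuous_ofReal.comp hg)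
    have e₁ := integral_ofReal (𝕜 := ℂ) (μ := (μ.vol α).measure) (f := g)
    have e₂ := integral_ofReal (𝕜 := ℂ) (μ := (μ.vol β).measure) (f := fun x => g (𝓕.proj k x))
    exact Complex.ofReal_injective (e₁.symm.trans (this.trans e₂))
  obtain ⟨δ, k₁, k₂⟩ := exists_ge_ge γ γ'
  rw [cons k₁ f hf, cons k₂ f' hf']
  have c₁ := hf.comp (𝓕.proj_smooth k₁).continuous
  have c₂ := hf'.comp (𝓕.proj_smooth k₂).continuous
  refine integral_mono (c₁.integrable_of_hasCompactSupport (HasCompactSupport.of_compactSpace _))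
    (c₂.integrable_of_hasCompactSupport (HasCompactSupport.of_compactSpace _)) fun y => ?_
  obtain ⟨A, rfl⟩ := limProj_surjective δ y
  simpa [proj_limProj] using h A

theorem VolumeForm.exists_measure [IsDirectedOrder L] (μ : 𝓕.VolumeForm) :
    ∃ m : Measure 𝓕.Limit, m.Regular ∧ IsFiniteMeasure m ∧
      ∀ (γ : L) (f : 𝓕.space γ → ℂ), Continuous f →
        ∫ A, f (𝓕.limProj γ A) ∂m = ∫ x, f x ∂(μ.vol γ).measure := by
  rcases isEmpty_or_nonempty L with hL | hL
  · exact ⟨0, inferInstance, inferInstance, fun γ => (hL.false γ).elim⟩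
  have int : ∀ {γ : L} {f : 𝓕.space γ → ℝ}, Continuous f → Integrable f (μ.vol γ).measure :=
    fun hf => hf.integrable_of_hasCompactSupport (HasCompactSupport.of_compactSpace _)
  -- real cylindrical functions and the integral on them
  have rep : ∀ F G : C(𝓕.Limit, ℝ),
      (∃ (γ : L) (f : 𝓕.space γ → ℝ), Continuous f ∧ ∀ A, F A = f (𝓕.limProj γ A)) →
      (∃ (γ : L) (f : 𝓕.space γ → ℝ), Continuous f ∧ ∀ A, G A = f (𝓕.limProj γ A)) →
      ∃ (γ : L) (f g : 𝓕.space γ → ℝ), Continuous f ∧ Continuous g ∧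
        (∀ A, F A = f (𝓕.limProj γ A)) ∧ ∀ A, G A = g (𝓕.limProj γ A) := by
    rintro F G ⟨γ, f, hf, hF⟩ ⟨γ', g, hg, hG⟩
    obtain ⟨δ, k₁, k₂⟩ := exists_ge_ge γ γ'
    exact ⟨δ, f ∘ 𝓕.proj k₁, g ∘ 𝓕.proj k₂, hf.comp (𝓕.proj_smooth k₁).continuous,
      hg.comp (𝓕.proj_smooth k₂).continuous, fun A => by simp [hF, proj_limProj],
      fun A => by simp [hG, proj_limProj]⟩
  let D : Submodule ℝ C(𝓕.Limit, ℝ) :=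
    { carrier := {F | ∃ (γ : L) (f : 𝓕.space γ → ℝ), Continuous f ∧
        ∀ A, F A = f (𝓕.limProj γ A)}
      zero_mem' := ⟨hL.some, fun _ => 0, continuous_const, fun _ => rfl⟩
      add_mem' := by
        intro F G hF hG
        obtain ⟨γ, f, g, hf, hg, h₁, h₂⟩ := rep F G hF hG
        exact ⟨γ, fun x => f x + g x, hf.add hg, fun A => by simp [h₁, h₂]⟩
      smul_mem' := by
        rintro c F ⟨γ, f, hf, hF⟩
        exact ⟨γ, fun x => c * f x, continuous_const.mul hf, fun A => by simp [hF]⟩ }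
  have hD : ∀ F : D, ∃ (γ : L) (f : 𝓕.space γ → ℝ), Continuous f ∧
      ∀ A, (F : C(𝓕.Limit, ℝ)) A = f (𝓕.limProj γ A) := fun F => F.2
  choose lab r hr hrF using hD
  let I : D → ℝ := fun F => ∫ x, r F x ∂(μ.vol (lab F)).measure
  have hI : ∀ (F : D) (γ : L) (f : 𝓕.space γ → ℝ), Continuous f →
      (∀ A, (F : C(𝓕.Limit, ℝ)) A = f (𝓕.limProj γ A)) →
      I F = ∫ x, f x ∂(μ.vol γ).measure := by
    intro F γ f hf h
    exact le_antisymm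
      (μ.integral_le_integral (hr F) hf fun A => by rw [← hrF, h])
      (μ.integral_le_integral hf (hr F) fun A => by rw [← hrF, h])
  let P : C(𝓕.Limit, ℝ) →ₗ.[ℝ] ℝ :=
    { domain := D
      toFun :=
        { toFun := I
          map_add' := by
            intro F G
            obtain ⟨γ, f, g, hf, hg, h₁, h₂⟩ := rep F G F.2 G.2
            rw [hI F γ f hf h₁, hI G γ g hg h₂, ← integral_add (int hf) (int hg)]
            exact hI _ γ (fun x => f x + g x) (hf.add hg) fun A => by simp [h₁, h₂]
          map_smul' := by
            intro c F
            rw [RingHom.id_apply, smul_eq_mul, ← integral_const_mul]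
            exact hI _ (lab F) (fun x => c * r F x) (continuous_const.mul (hr F))
              fun A => by simp [hrF] } }
  let S : PointedCone ℝ C(𝓕.Limit, ℝ) :=
    { carrier := {F | ∀ A, 0 ≤ F A}
      zero_mem' := fun _ => le_rfl
      add_mem' := fun hF hG A => add_nonneg (hF A) (hG A)
      smul_mem' := fun c _ hF A => mul_nonneg c.2 (hF A) }
  obtain ⟨Λ, hΛ, hΛ0⟩ := riesz_extension S P
    (by
      intro F hF
      have := μ.integral_le_integral (γ := lab F) (γ' := lab F) (f := fun _ => 0)
        continuous_const (hr F) fun A => by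
          rw [← hrF]
          exact hF A
      rw [integral_zero] at this
      exact this)
    (by
      intro F
      refine ⟨⟨ContinuousMap.const _ ‖F‖, hL.some, fun _ => ‖F‖, continuous_const,
        fun _ => rfl⟩, fun A => ?_⟩
      have h1 := F.norm_coe_le_norm A
      rw [Real.norm_eq_abs] at h1
      have h2 := neg_abs_le (F A)
      change 0 ≤ ‖F‖ + F A
      linarith)
  let Λ' : CompactlySupportedContinuousMap 𝓕.Limit ℝ →ₚ[ℝ] ℝ :=
    { toFun F := Λ F.toContinuousMap
      map_add' F G := Λ.map_add F.toContinuousMap G.toContinuousMap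
      map_smul' c F := Λ.map_smul c F.toContinuousMap
      monotone' := by
        intro F G h
        have := hΛ0 (G.toContinuousMap - F.toContinuousMap) fun A => sub_nonneg.2 (h A)
        rw [map_sub] at this
        exact sub_nonneg.1 this }
  have real : ∀ (γ : L) (f : 𝓕.space γ → ℝ), Continuous f →
      ∫ A, f (𝓕.limProj γ A) ∂(RealRMK.rieszMeasure Λ') = ∫ x, f x ∂(μ.vol γ).measure := by
    intro γ f hf
    let F : C(𝓕.Limit, ℝ) := ⟨fun A => f (𝓕.limProj γ A), hf.comp (continuous_limProj γ)⟩
    have hF : F ∈ D := ⟨γ, f, hf, fun _ => rfl⟩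
    have e := RealRMK.integral_rieszMeasure Λ' ⟨F, HasCompactSupport.of_compactSpace _⟩
    exact e.trans ((hΛ ⟨F, hF⟩).trans (hI ⟨F, hF⟩ γ f hf fun _ => rfl))
  refine ⟨RealRMK.rieszMeasure Λ', inferInstance, inferInstance, fun γ f hf => ?_⟩
  have i₁ : Integrable (fun A => f (𝓕.limProj γ A)) (RealRMK.rieszMeasure Λ') :=
    (hf.comp (continuous_limProj γ)).integrable_of_hasCompactSupport
      (HasCompactSupport.of_compactSpace _)
  have i₂ : Integrable f (μ.vol γ).measure :=
    hf.integrable_of_hasCompactSupport (HasCompactSupport.of_compactSpace _)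
  apply Complex.ext
  · have e := real γ (fun x => (f x).re) (Complex.continuous_re.comp hf)
    exact (integral_re i₁).symm.trans (e.trans (integral_re i₂))
  · have e := real γ (fun x => (f x).im) (Complex.continuous_im.comp hf)
    exact (integral_im i₁).symm.trans (e.trans (integral_im i₂))

/-- The regular Borel measure on the projective limit defined by a volume form: it satisfies
`∫ f ∘ p_γ dμ = ∫ f μ_γ` for all continuous functions `f` on a member of the family. -/
def VolumeForm.measure [IsDirectedOrder L] (μ : 𝓕.VolumeForm) : Measure 𝓕.Limit :=
  μ.exists_measure.choose

namespace VectorField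

variable {γ₀ : L}

/-- The function `X_γ(f)` on a member of the family: the derivative of a complex valued function
`f` along the vector field `X_γ`. -/
def derivMember (X : 𝓕.VectorField γ₀) (γ : L) (h : γ₀ ≤ γ) (f : 𝓕.space γ → ℂ)
    (x : 𝓕.space γ) : ℂ :=
  mfderiv 𝓘(ℝ, Model (𝓕.dim γ)) 𝓘(ℝ, ℂ) f x (X.field γ h x)

theorem derivMember_proj (X : 𝓕.VectorField γ₀) {γ γ' : L} (h : γ₀ ≤ γ) (h' : γ ≤ γ')
    {f : 𝓕.space γ → ℂ} (hf : ContMDiff 𝓘(ℝ, Model (𝓕.dim γ)) 𝓘(ℝ, ℂ) 1 f) (x : 𝓕.space γ') :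
    X.derivMember γ' (h.trans h') (f ∘ 𝓕.proj h') x = X.derivMember γ h f (𝓕.proj h' x) := by
  unfold derivMember
  rw [mfderiv_comp x ((hf _).mdifferentiableAt one_ne_zero)
    ((𝓕.proj_smooth h' x).mdifferentiableAt (by simp)), ← X.consistent γ γ' h h' x]
  rfl

open Classical in
/-- The derivation defined by a vector field `X` based at `γ₀`: if the function `F` on the limit is
represented by a `C¹` function `f` on a member with label `γ ≥ γ₀`, then `X(F)` is represented by
`X_γ(f)` (this is independent of the choice of `γ` and `f`, see `deriv_comp_limProj`). -/
def deriv (X : 𝓕.VectorField γ₀) (F : 𝓕.Limit → ℂ) : 𝓕.Limit → ℂ :=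
  if H : ∃ (γ : L) (_ : γ₀ ≤ γ) (f : 𝓕.space γ → ℂ),
      ContMDiff 𝓘(ℝ, Model (𝓕.dim γ)) 𝓘(ℝ, ℂ) 1 f ∧ F = f ∘ 𝓕.limProj γ
  then X.derivMember H.choose H.choose_spec.choose H.choose_spec.choose_spec.choose ∘
    𝓕.limProj H.choose
  else 0

theorem deriv_comp_limProj [IsDirectedOrder L] (X : 𝓕.VectorField γ₀) {γ : L} (h : γ₀ ≤ γ)
    {f : 𝓕.space γ → ℂ} (hf : ContMDiff 𝓘(ℝ, Model (𝓕.dim γ)) 𝓘(ℝ, ℂ) 1 f) :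
    X.deriv (f ∘ 𝓕.limProj γ) = X.derivMember γ h f ∘ 𝓕.limProj γ := by
  have H : ∃ (γ' : L) (_ : γ₀ ≤ γ') (g : 𝓕.space γ' → ℂ),
      ContMDiff 𝓘(ℝ, Model (𝓕.dim γ')) 𝓘(ℝ, ℂ) 1 g ∧ f ∘ 𝓕.limProj γ = g ∘ 𝓕.limProj γ' :=
    ⟨γ, h, f, hf, rfl⟩
  rw [deriv, dif_pos H]
  have hspec := H.choose_spec.choose_spec.choose_spec
  generalize H.choose_spec.choose_spec.choose = g at hspec ⊢
  obtain ⟨hg, hgf⟩ := hspec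
  obtain ⟨δ, k₁, k₂⟩ := exists_ge_ge γ H.choose
  funext A
  have e1 := X.derivMember_proj h k₁ hf (𝓕.limProj δ A)
  have e2 := X.derivMember_proj H.choose_spec.choose k₂ hg (𝓕.limProj δ A)
  have e3 : f ∘ 𝓕.proj k₁ = g ∘ 𝓕.proj k₂ := by
    funext y
    obtain ⟨B, rfl⟩ := limProj_surjective δ y
    simpa [proj_limProj] using congrFun hgf B
  rw [proj_limProj] at e1 e2
  simp only [Function.comp_apply, ← e1, ← e2, e3]

/-- The vector field `X` is compatible with the volume form `μ`:
`div_{μ_γ'} X_γ'` is the pull-back of `div_{μ_γ} X_γ` for all `γ' ≥ γ ≥ γ₀`. -/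
def Compatible (X : 𝓕.VectorField γ₀) (μ : 𝓕.VolumeForm) : Prop :=
  ∀ (γ γ' : L) (h : γ₀ ≤ γ) (h' : γ ≤ γ') (x : 𝓕.space γ'),
    divergence (μ.vol γ) (X.field γ h) (𝓕.proj h' x) =
      divergence (μ.vol γ') (X.field γ' (h.trans h')) x

/-- The divergence of a vector field based at `γ₀` with respect to a volume form: the cylindrical
function represented by `div_{μ_γ} X_γ` at `γ = γ₀` (and, if `X` is compatible with `μ`, by
`div_{μ_γ} X_γ` at any `γ ≥ γ₀`, see `div_eq`). -/
def div (μ : 𝓕.VolumeForm) (X : 𝓕.VectorField γ₀) (A : 𝓕.Limit) : ℂ :=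
  (divergence (μ.vol γ₀) (X.field γ₀ le_rfl) (𝓕.limProj γ₀ A) : ℂ)

theorem div_eq {μ : 𝓕.VolumeForm} {X : 𝓕.VectorField γ₀} (hX : X.Compatible μ) {γ : L}
    (h : γ₀ ≤ γ) (A : 𝓕.Limit) :
    div μ X A = (divergence (μ.vol γ) (X.field γ h) (𝓕.limProj γ A) : ℂ) := by
  rw [div, ← proj_limProj h A, hX γ₀ γ le_rfl h]

/-- The commutator `[X, Y]` of vector fields based at `γ₁` and `γ₂`, as a vector field
based at a label `γ₃ ≥ γ₁, γ₂`: its members are the Lie brackets `[X_γ, Y_γ]` for `γ ≥ γ₃`. -/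
def bracket {γ₁ γ₂ γ₃ : L} (X : 𝓕.VectorField γ₁) (Y : 𝓕.VectorField γ₂) (h₁ : γ₁ ≤ γ₃)
    (h₂ : γ₂ ≤ γ₃) : 𝓕.VectorField γ₃ where
  field γ h := mlieBracket 𝓘(ℝ, Model (𝓕.dim γ)) (X.field γ (h₁.trans h)) (Y.field γ (h₂.trans h))
  smooth γ h := by
    have : IsManifold 𝓘(ℝ, Model (𝓕.dim γ)) (((⊤ : ℕ∞) : ℕ∞ω) + 1) (𝓕.space γ) :=
      𝓕.manifold γ
    have : IsManifold 𝓘(ℝ, Model (𝓕.dim γ)) (minSmoothness ℝ 2) (𝓕.space γ) :=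
      IsManifold.of_le (n := ∞) (by rw [minSmoothness_of_isRCLikeNormedField]; norm_cast)
    have : IsManifold 𝓘(ℝ, Model (𝓕.dim γ)) (minSmoothness ℝ 3) (𝓕.space γ) :=
      IsManifold.of_le (n := ∞) (by rw [minSmoothness_of_isRCLikeNormedField]; norm_cast)
    exact ContDiff.mlieBracket_vectorField (n := ⊤) (m := ⊤) (X.smooth γ _) (Y.smooth γ _)
      (by simp [minSmoothness_of_isRCLikeNormedField])
  consistent γ γ' h h' x :=
    mlieBracket_related (𝓕.proj_smooth h') (X.smooth _ _) (Y.smooth _ _) (X.smooth _ _)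
      (Y.smooth _ _) (X.consistent γ γ' _ h') (Y.consistent γ γ' _ h') x

end VectorField
end ProjFamily
end ProjGeom

end

noncomputable section

namespace ProjGeom

/-! ### Top-degree forms, divergence and integration by parts in coordinates -/

section Coordinates

variable {d : ℕ}

/-! Both claims reduce to a single compact manifold. Since `L` is directed, cylindrical functions
and vector fields all have representatives on one member `𝓕.space δ`. Integrals over the limit of
continuous functions pulled back from that member are integrals against `μ.vol δ`. Compatibility
says precisely that the divergences on the members form one cylindrical function. It remains to
prove two facts on a compact manifold and to check that they respect the projections.

The common tool is the coordinate formula for the divergence. In a chart a volume form is a nowhere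
zero density `r`, and `L_W` acts on it by `W(r)/r + tr DW`, here `densityDiv`. The definition of
`divergence` uses a different chart at each point. Naturality of the Lie derivative under transition
maps (`lieDerivCoord_comp`) turns it into a formula valid throughout a fixed chart
(`divergence_symm`), which also shows that the divergence is smooth.

For (i), `|r| (W(u) + div W · u)` is the Euclidean divergence of `u |r| W`, so its integral vanishes
when `u` is compactly supported in the chart. The measure of the volume form restricts on each chart
to `|r| dy` (`VolForm.restrict_measure`, by the change of variables formula), and a partition of
unity gives `∫ (V(f) + div V · f) = 0` on the whole manifold. Applied to a product `f g`, the
Leibniz rule gives (i).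

For (ii), symmetry of second derivatives and `tr(AB) = tr(BA)` give `div [X, Y] = X(div Y) - Y(div
X)` in a chart (`densityDiv_lieBracket`), hence on every member. The right-hand side is consistent
under the projections, because the fields are related by them and the divergences are pull-backs.
This gives compatibility of the bracket. -/

theorem derivationForm_stdBasis (η : Model d [⋀^Fin d]→L[ℝ] ℝ) (B : Model d →L[ℝ] Model d) :
    derivationForm η B (stdBasis d) =
      LinearMap.trace ℝ (Model d) (B : Model d →ₗ[ℝ] Model d) * η (stdBasis d) := by
  have hB : ∀ i, B (stdBasis d i) = ∑ j, (B (stdBasis d i)) j • stdBasis d j := by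
    intro i
    have := (EuclideanSpace.basisFun (Fin d) ℝ).sum_repr (B (stdBasis d i))
    simpa [stdBasis] using this.symm
  rw [derivationForm_apply, LinearMap.trace_eq_matrix_trace ℝ
    (EuclideanSpace.basisFun (Fin d) ℝ).toBasis, Matrix.trace, Finset.sum_mul]
  refine Finset.sum_congr rfl fun i _ => ?_
  have h1 : η (Function.update (stdBasis d) i (B (stdBasis d i))) =
      ∑ j, η (Function.update (stdBasis d) i ((B (stdBasis d i)) j • stdBasis d j)) := by
    conv_lhs => rw [hB i]
    exact η.toMultilinearMap.map_update_sum Finset.univ i _ _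
  -- Replacing the `i`-th vector by another basis vector repeats an argument, so only the diagonal
  -- entry of `B` contributes.
  rw [h1, Finset.sum_eq_single i]
  · rw [η.map_update_smul, Function.update_eq_self]
    simp [LinearMap.toMatrix_apply, stdBasis]
  · intro j _ hj
    rw [η.map_update_smul, ContinuousAlternatingMap.map_eq_zero_of_eq η _ (i := i) (j := j) _
      hj.symm, smul_zero]
    simp [Function.update_of_ne hj]
  · simp

/-- An alternating form is determined on injective families of basis vectors. In top degree these
are permutations of the basis, so only a sign changes. This is what allows a volume form to be
handled as a scalar density. -/
theorem ext_stdBasis {η ν : Model d [⋀^Fin d]→L[ℝ] ℝ} (h : η (stdBasis d) = ν (stdBasis d)) :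
    η = ν := by
  apply ContinuousAlternatingMap.toAlternatingMap_injective
  refine Module.Basis.ext_alternating (EuclideanSpace.basisFun (Fin d) ℝ).toBasis fun v hv => ?_
  obtain ⟨σ, rfl⟩ : ∃ σ : Equiv.Perm (Fin d), v = σ :=
    ⟨Equiv.ofBijective v (Finite.injective_iff_bijective.1 hv), rfl⟩
  have e1 := η.toAlternatingMap.map_perm (stdBasis d) σ
  have e2 := ν.toAlternatingMap.map_perm (stdBasis d) σ
  have e3 : (fun i => (EuclideanSpace.basisFun (Fin d) ℝ).toBasis (σ i)) = stdBasis d ∘ σ := by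
    funext i
    simp [stdBasis]
  rw [e3, e1, e2]
  simp [h]

theorem stdBasis_ne_zero {η : Model d [⋀^Fin d]→L[ℝ] ℝ} (h : η ≠ 0) : η (stdBasis d) ≠ 0 :=
  fun h0 => h (ext_stdBasis (by simpa using h0))

/-- Source of the Jacobian factor relating densities in two charts, the same factor as in the change
of variables formula for integrals. -/
theorem compContinuousLinearMap_stdBasis (η : Model d [⋀^Fin d]→L[ℝ] ℝ)
    (B : Model d →L[ℝ] Model d) :
    η.compContinuousLinearMap B (stdBasis d) = B.det * η (stdBasis d) := by
  have h : stdBasis d = (EuclideanSpace.basisFun (Fin d) ℝ).toBasis := by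
    funext i
    simp [stdBasis]
  have hη := congrArg (fun f => f (B ∘ stdBasis d)) (AlternatingMap.eq_smul_basis_det
    (EuclideanSpace.basisFun (Fin d) ℝ).toBasis η.toAlternatingMap)
  rw [ContinuousAlternatingMap.compContinuousLinearMap_apply]
  refine hη.trans ?_
  rw [AlternatingMap.smul_apply, h]
  have := (EuclideanSpace.basisFun (Fin d) ℝ).toBasis.det_comp (B : Model d →ₗ[ℝ] Model d)
    (EuclideanSpace.basisFun (Fin d) ℝ).toBasis
  rw [Module.Basis.det_self, mul_one] at this
  refine (congrArg (fun t => _ • t) this).trans ?_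
  simp [ContinuousLinearMap.det, mul_comm]

/-- Naturality of the coordinate Lie derivative of top degree forms under a change of
coordinates. -/
theorem lieDerivCoord_comp {τ : Model d → Model d} {W W' : Model d → Model d}
    {η η' : Model d → Model d [⋀^Fin d]→L[ℝ] ℝ} {y : Model d} (hτ : ContDiffAt ℝ 2 τ y)
    (hW : DifferentiableAt ℝ W y) (hW' : DifferentiableAt ℝ W' (τ y))
    (hη' : DifferentiableAt ℝ η' (τ y))
    (eW : ∀ᶠ z in 𝓝 y, W' (τ z) = fderiv ℝ τ z (W z))
    (eη : ∀ᶠ z in 𝓝 y, η z = (η' (τ z)).compContinuousLinearMap (fderiv ℝ τ z)) :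
    lieDerivCoord W η y =
      (lieDerivCoord W' η' (τ y)).compContinuousLinearMap (fderiv ℝ τ y) := by
  have dτ : DifferentiableAt ℝ τ y := hτ.differentiableAt (by simp)
  have dDτ : DifferentiableAt ℝ (fderiv ℝ τ) y :=
    (hτ.fderiv_right (m := 1) (by norm_num)).differentiableAt one_ne_zero
  have symm : ∀ v w, fderiv ℝ (fderiv ℝ τ) y v w = fderiv ℝ (fderiv ℝ τ) y w v :=
    fun v w => (hτ.isSymmSndFDerivAt (by simp)).eq v w
  -- Differentiating `τ^* η'` gives one term with the derivative of `η'` and, for each slot, one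
  -- term with the second derivative of `τ`.
  have kη := (hη'.hasFDerivAt.comp y dτ.hasFDerivAt).continuousAlternatingMapCompContinuousLinearMap
    dDτ.hasFDerivAt
  have kη' := (kη.congr_of_eventuallyEq eη).fderiv
  -- Differentiating `W' ∘ τ = Dτ · W` in two ways expresses `DW' ∘ Dτ` as `Dτ ∘ DW` plus a second
  -- derivative of `τ` in the direction `W`.
  have kW := (hW'.hasFDerivAt.comp y dτ.hasFDerivAt).congr_of_eventuallyEq
    (Filter.EventuallyEq.symm eW)
  have kW' := kW.unique (dDτ.hasFDerivAt.clm_apply hW.hasFDerivAt)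
  ext v
  have e0 := eW.self_of_nhds
  unfold lieDerivCoord
  rw [kη', eη.self_of_nhds]
  simp only [ContinuousAlternatingMap.compContinuousLinearMap_apply,
    ContinuousAlternatingMap.add_apply, derivationForm_apply, add_apply,
    ContinuousLinearMap.comp_apply, e0]
  rw [add_assoc]
  congr 1
  rw [ContinuousAlternatingMap.fderivCompContinuousLinearMap_apply, ← Finset.sum_add_distrib]
  refine Finset.sum_congr rfl fun i _ => ?_
  have u1 : (fun j => Function.update (fun _ : Fin d => fderiv ℝ τ y) i
      (fderiv ℝ (fderiv ℝ τ) y (W y)) j (v j)) =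
      Function.update (fderiv ℝ τ y ∘ v) i (fderiv ℝ (fderiv ℝ τ) y (W y) (v i)) := by
    funext j
    rcases eq_or_ne j i with rfl | hj
    · simp
    · simp [Function.update_of_ne hj]
  have u2 : fderiv ℝ τ y ∘ Function.update v i (fderiv ℝ W y (v i)) =
      Function.update (fderiv ℝ τ y ∘ v) i (fderiv ℝ τ y (fderiv ℝ W y (v i))) :=
    Function.comp_update _ _ _ _
  have u3 := congrArg (fun T : Model d →L[ℝ] Model d => T (v i)) kW'
  simp only [ContinuousLinearMap.comp_apply, add_apply,
    ContinuousLinearMap.flip_apply] at u3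
  rw [u1, u2]
  simp only [Function.comp_apply]
  -- The second derivatives of `τ` from the form and from the field have their arguments in opposite
  -- order; symmetry identifies them.
  rw [u3, add_comm, symm, ContinuousAlternatingMap.map_update_add]

variable (d) in
/-- The trace of an endomorphism of the model space, as a continuous linear map. -/
def traceCLM : (Model d →L[ℝ] Model d) →L[ℝ] ℝ :=
  LinearMap.toContinuousLinearMap (LinearMap.trace ℝ (Model d) ∘ₗ ContinuousLinearMap.coeLM ℝ)

theorem traceCLM_apply (B : Model d →L[ℝ] Model d) :
    traceCLM d B = LinearMap.trace ℝ (Model d) (B : Model d →ₗ[ℝ] Model d) := rfl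

theorem traceCLM_comp_comm (A B : Model d →L[ℝ] Model d) :
    traceCLM d (A ∘L B) = traceCLM d (B ∘L A) :=
  LinearMap.trace_mul_comm ℝ (A : Model d →ₗ[ℝ] Model d) (B : Model d →ₗ[ℝ] Model d)

theorem traceCLM_eq_sum (B : Model d →L[ℝ] Model d) :
    traceCLM d B = ∑ i, B (stdBasis d i) i := by
  rw [traceCLM_apply, LinearMap.trace_eq_matrix_trace ℝ
    (EuclideanSpace.basisFun (Fin d) ℝ).toBasis, Matrix.trace]
  simp [LinearMap.toMatrix_apply, stdBasis]

/-- The divergence of a vector field `W` on the model space with respect to the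
density `r dy₁ ⋯ dy_d`. -/
def densityDiv (r : Model d → ℝ) (W : Model d → Model d) (y : Model d) : ℝ :=
  fderiv ℝ r y (W y) / r y + traceCLM d (fderiv ℝ W y)

/-- Evaluation on a fixed frame is linear and commutes with differentiation, while the zeroth-order
term contributes the trace. This passes from the Lie derivative of forms to the scalar `densityDiv`.
-/
theorem lieDerivCoord_stdBasis {W : Model d → Model d} {η : Model d → Model d [⋀^Fin d]→L[ℝ] ℝ}
    {y : Model d} (hη : DifferentiableAt ℝ η y) (h0 : η y (stdBasis d) ≠ 0) :
    lieDerivCoord W η y (stdBasis d) =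
      densityDiv (fun z => η z (stdBasis d)) W y * η y (stdBasis d) := by
  have h := (((ContinuousAlternatingMap.apply ℝ (Model d) ℝ (stdBasis d)).hasFDerivAt).comp y
    hη.hasFDerivAt).fderiv
  have h' : fderiv ℝ (fun z => η z (stdBasis d)) y (W y) = fderiv ℝ η y (W y) (stdBasis d) :=
    congrArg (fun T : Model d →L[ℝ] ℝ => T (W y)) h
  rw [lieDerivCoord, ContinuousAlternatingMap.add_apply, derivationForm_stdBasis, densityDiv, h',
    traceCLM_apply]
  field_simp

/-- The sign cancels in the logarithmic derivative of `r`. The measure only sees `|r|`, whereas the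
form has density `r`. -/
theorem densityDiv_abs {r : Model d → ℝ} {W : Model d → Model d} {y : Model d}
    (hr : DifferentiableAt ℝ r y) (h0 : r y ≠ 0) :
    densityDiv (fun z => |r z|) W y = densityDiv r W y := by
  have h := ((hasDerivAt_abs h0).hasFDerivAt.comp y hr.hasFDerivAt).fderiv
  have h' : fderiv ℝ (fun z => |r z|) y (W y) = SignType.sign (r y) * fderiv ℝ r y (W y) := by
    refine (congrArg (fun T : Model d →L[ℝ] ℝ => T (W y)) h).trans ?_
    simp [mul_comm]
  rw [densityDiv, densityDiv, h']
  congr 1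
  rcases lt_or_gt_of_ne h0 with h1 | h1
  · simp [abs_of_neg h1, h1, neg_div_neg_eq]
  · simp [abs_of_pos h1, h1]

theorem contDiffAt_densityDiv {r : Model d → ℝ} {W : Model d → Model d} {y : Model d} {m : ℕ∞ω}
    (hr : ContDiffAt ℝ (m + 1) r y) (hW : ContDiffAt ℝ (m + 1) W y) (h0 : r y ≠ 0) :
    ContDiffAt ℝ m (densityDiv r W) y :=
  (((hr.fderiv_right le_rfl).clm_apply (hW.of_le le_self_add)).div (hr.of_le le_self_add) h0).add
    ((traceCLM d).contDiff.contDiffAt.comp y (hW.fderiv_right le_rfl))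

/-- The divergence is the derivative of `log |r|` along the field plus the trace of its Jacobian. In
the antisymmetrised expression the Hessian terms of `r` cancel by symmetry and the products of first
derivatives of `r` cancel. The traces of the two products of Jacobians agree, so the trace of the
derivative of the bracket contains only the terms with second derivatives of `X` and `Y`. -/
theorem densityDiv_lieBracket {r : Model d → ℝ} {X Y : Model d → Model d} {y : Model d}
    (hr : ContDiffAt ℝ 2 r y) (hX : ContDiffAt ℝ 2 X y) (hY : ContDiffAt ℝ 2 Y y)
    (h0 : r y ≠ 0) :
    densityDiv r (lieBracket ℝ X Y) y =
      fderiv ℝ (densityDiv r Y) y (X y) - fderiv ℝ (densityDiv r X) y (Y y) := by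
  have d1 : ∀ {F : Type} [NormedAddCommGroup F] [NormedSpace ℝ F] {f : Model d → F},
      ContDiffAt ℝ 2 f y → HasFDerivAt f (fderiv ℝ f y) y :=
    fun hf => (hf.differentiableAt (by simp)).hasFDerivAt
  have d2 : ∀ {F : Type} [NormedAddCommGroup F] [NormedSpace ℝ F] {f : Model d → F},
      ContDiffAt ℝ 2 f y → HasFDerivAt (fderiv ℝ f) (fderiv ℝ (fderiv ℝ f) y) y :=
    fun hf => ((hf.fderiv_right (m := 1) (by norm_num)).differentiableAt one_ne_zero).hasFDerivAt
  have symm : ∀ {F : Type} [NormedAddCommGroup F] [NormedSpace ℝ F] {f : Model d → F},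
      ContDiffAt ℝ 2 f y → ∀ v w, fderiv ℝ (fderiv ℝ f) y v w = fderiv ℝ (fderiv ℝ f) y w v :=
    fun hf v w => (hf.isSymmSndFDerivAt (by simp)).eq v w
  have key : ∀ {V Z : Model d → Model d}, ContDiffAt ℝ 2 V y →
      fderiv ℝ (densityDiv r V) y (Z y) =
        (fderiv ℝ (fderiv ℝ r) y (Z y) (V y) + fderiv ℝ r y (fderiv ℝ V y (Z y))) / r y
          - fderiv ℝ r y (V y) * fderiv ℝ r y (Z y) / r y ^ 2
          + traceCLM d (fderiv ℝ (fderiv ℝ V) y (Z y)) := by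
    intro V Z hV
    have k := (((d2 hr).clm_apply (d1 hV)).mul ((hasDerivAt_inv h0).hasFDerivAt.comp y (d1 hr))).add
      ((traceCLM d).hasFDerivAt.comp y (d2 hV))
    refine (congrArg (fun T : Model d →L[ℝ] ℝ => T (Z y)) k.fderiv).trans ?_
    simp
    field_simp
    ring
  have kb : fderiv ℝ (lieBracket ℝ X Y) y =
      (fderiv ℝ (fderiv ℝ Y) y (X y) + fderiv ℝ Y y ∘L fderiv ℝ X y) -
      (fderiv ℝ (fderiv ℝ X) y (Y y) + fderiv ℝ X y ∘L fderiv ℝ Y y) := by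
    have k := ((d2 hY).clm_apply (d1 hX)).sub ((d2 hX).clm_apply (d1 hY))
    refine k.fderiv.trans ?_
    ext1 v
    simp [symm hX v, symm hY v, add_comm]
  rw [key hY, key hX, densityDiv, kb, lieBracket]
  simp only [map_sub, map_add, traceCLM_comp_comm (fderiv ℝ Y y)]
  rw [symm hr (Y y) (X y)]
  field_simp
  ring

/-- Integration by parts against the constant function `1`; compact support of `k` provides the
integrability. -/
theorem integral_fderiv_eq_zero {k : Model d → ℂ} (hk : ContDiff ℝ 1 k)
    (hc : HasCompactSupport k) (v : Model d) : ∫ y, fderiv ℝ k y v = 0 := by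
  have h := integral_mul_fderiv_eq_neg_fderiv_mul_of_integrable (𝕜 := ℂ) (μ := volume)
    (f := fun _ : Model d => (1 : ℂ)) (g := k) (v := v) (by simp)
    (by
      simp only [one_mul]
      exact ((hk.continuous_fderiv one_ne_zero).clm_apply
        continuous_const).integrable_of_hasCompactSupport (hc.fderiv_apply ℝ v))
    (by
      simp only [one_mul]
      exact hk.continuous.integrable_of_hasCompactSupport hc)
    (fun _ _ => differentiableAt_const _) (fun y _ => hk.differentiable one_ne_zero y)
  simpa using h

/-- The divergence theorem for a compactly supported function on an open subset of the
model space equipped with a density. -/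
theorem integral_densityDiv_eq_zero {r : Model d → ℝ} {W : Model d → Model d} {u : Model d → ℂ}
    {T K : Set (Model d)} (hT : IsOpen T) (hr : ContDiffOn ℝ 1 r T) (hW : ContDiffOn ℝ 1 W T)
    (hu : ContDiffOn ℝ 1 u T) (h0 : ∀ y ∈ T, r y ≠ 0) (hK : IsCompact K) (hKT : K ⊆ T)
    (huK : ∀ y ∈ T, y ∉ K → u y = 0) :
    ∫ y in T, |r y| • (fderiv ℝ u y (W y) + (densityDiv r W y : ℂ) * u y) = 0 := by
  -- `c` lists the components of the flux `u |r| W`, and `k` extends them by zero outside `T`. Since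
  -- `u` vanishes on `T` outside the compact set `K ⊆ T`, the extension is `C¹` with compact
  -- support.
  let c : Fin d → Model d → ℂ := fun i y => u y * ((|r y| * W y i : ℝ) : ℂ)
  let k : Fin d → Model d → ℂ := fun i => T.indicator (c i)
  have kT : ∀ i, ∀ y ∈ T, k i =ᶠ[𝓝 y] c i := fun i y hy => by
    filter_upwards [hT.mem_nhds hy] with z hz
    exact indicator_of_mem hz _
  have kK : ∀ i, ∀ y ∉ K, k i y = 0 := fun i y hy => by
    by_cases hyT : y ∈ T
    · simp [k, c, hyT, huK y hyT hy]
    · simp [k, hyT]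
  have hcT : ∀ i, ∀ y ∈ T, ContDiffAt ℝ 1 (c i) y := fun i y hy => by
    have n := hT.mem_nhds hy
    have h1 : ContDiffAt ℝ 1 (fun z => |r z| * W z i) y :=
      ((hr.contDiffAt n).abs (h0 y hy)).mul
        ((EuclideanSpace.proj (𝕜 := ℝ) i).contDiff.contDiffAt.comp y (hW.contDiffAt n))
    exact (hu.contDiffAt n).mul (Complex.ofRealCLM.contDiff.contDiffAt.comp y h1)
  have hk : ∀ i, ContDiff ℝ 1 (k i) := fun i => contDiff_iff_contDiffAt.2 fun y => by
    by_cases hy : y ∈ T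
    · exact (hcT i y hy).congr_of_eventuallyEq (kT i y hy)
    · refine (contDiffAt_const (c := (0 : ℂ))).congr_of_eventuallyEq ?_
      filter_upwards [hK.isClosed.isOpen_compl.mem_nhds fun h => hy (hKT h)] with z hz
      exact kK i z hz
  have hkc : ∀ i, HasCompactSupport (k i) := fun i => HasCompactSupport.intro hK (kK i)
  -- The integrand is the Euclidean divergence of the flux, by the product rule and the expansion of
  -- `W y` in the standard basis.
  have point : ∀ y ∈ T, |r y| • (fderiv ℝ u y (W y) + (densityDiv r W y : ℂ) * u y) =
      ∑ i, fderiv ℝ (k i) y (stdBasis d i) := by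
    intro y hy
    have n := hT.mem_nhds hy
    have ur := ((hr.contDiffAt n).abs (h0 y hy)).differentiableAt one_ne_zero
    have uW := (hW.contDiffAt n).differentiableAt one_ne_zero
    have uu := (hu.contDiffAt n).differentiableAt one_ne_zero
    have ha : |r y| ≠ 0 := abs_ne_zero.2 (h0 y hy)
    have e : ∀ i, fderiv ℝ (k i) y (stdBasis d i) =
        u y * ((|r y| * (fderiv ℝ W y (stdBasis d i)) i +
          W y i * fderiv ℝ (fun z => |r z|) y (stdBasis d i) : ℝ) : ℂ) +
        ((|r y| * W y i : ℝ) : ℂ) * fderiv ℝ u y (stdBasis d i) := by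
      intro i
      rw [(kT i y hy).fderiv_eq]
      have h1 := ur.hasFDerivAt.mul
        ((EuclideanSpace.proj (𝕜 := ℝ) i).hasFDerivAt.comp y uW.hasFDerivAt)
      have h2 := uu.hasFDerivAt.mul (Complex.ofRealCLM.hasFDerivAt.comp y h1)
      refine (congrArg (fun S : Model d →L[ℝ] ℂ => S (stdBasis d i)) h2.fderiv).trans ?_
      simp [mul_add]
    have hsum : W y = ∑ i, W y i • stdBasis d i := by
      have := (EuclideanSpace.basisFun (Fin d) ℝ).sum_repr (W y)
      simpa [stdBasis] using this.symm
    have s1 : ∀ {F : Type} [NormedAddCommGroup F] [NormedSpace ℝ F] (S : Model d →L[ℝ] F),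
        S (W y) = ∑ i, W y i • S (stdBasis d i) := fun S => by
      conv_lhs => rw [hsum]
      simp
    rw [Finset.sum_congr rfl fun i _ => e i, ← densityDiv_abs
      ((hr.contDiffAt n).differentiableAt one_ne_zero) (h0 y hy), densityDiv, s1 (fderiv ℝ u y),
      s1 (fderiv ℝ (fun z => |r z|) y), traceCLM_eq_sum, Finset.sum_add_distrib, ← Finset.mul_sum,
      ← Complex.ofReal_sum, Finset.sum_add_distrib, ← Finset.mul_sum]
    have s2 : ∑ i, ((|r y| * W y i : ℝ) : ℂ) * fderiv ℝ u y (stdBasis d i) =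
        |r y| • ∑ i, W y i • fderiv ℝ u y (stdBasis d i) := by
      rw [Finset.smul_sum]
      refine Finset.sum_congr rfl fun i _ => ?_
      simp only [Complex.real_smul, Complex.ofReal_mul]
      ring
    rw [s2, smul_add, add_comm]
    congr 1
    have ha' : ((|r y| : ℝ) : ℂ) ≠ 0 := Complex.ofReal_ne_zero.2 ha
    simp only [Complex.real_smul, smul_eq_mul]
    push_cast
    field_simp
    ring
  rw [setIntegral_congr_fun hT.measurableSet point, setIntegral_eq_integral_of_forall_compl_eq_zero]
  · rw [integral_finsetSum]
    · exact Finset.sum_eq_zero fun i _ => integral_fderiv_eq_zero (hk i) (hkc i) _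
    · intro i _
      exact (((hk i).continuous_fderiv one_ne_zero).clm_apply
        continuous_const).integrable_of_hasCompactSupport ((hkc i).fderiv_apply ℝ _)
  -- A point outside `T` lies in the open complement of `K`, where every `k i` vanishes, so the
  -- integral over `T` equals that over the whole space.
  · intro y hy
    refine Finset.sum_eq_zero fun i _ => ?_
    have : k i =ᶠ[𝓝 y] fun _ => 0 := by
      filter_upwards [hK.isClosed.isOpen_compl.mem_nhds fun h => hy (hKT h)] with z hz
      exact kK i z hz
    rw [this.fderiv_eq]
    simp

end Coordinates

/-! ### Fields, forms and divergence in the charts of a manifold -/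

section Charts

variable {d : ℕ} {N : Type*} [TopologicalSpace N] [ChartedSpace (Model d) N]

/-- The derivative of the inverse of the preferred chart around `i`, as an endomorphism of the
model space. -/
def chartSymmDeriv (i : N) (y : Model d) : Model d →L[ℝ] Model d :=
  mfderiv 𝓘(ℝ, Model d) 𝓘(ℝ, Model d) (extChartAt 𝓘(ℝ, Model d) i).symm y

/-- The derivative of a vector valued function along a vector field. -/
def derivAlong {F : Type*} [NormedAddCommGroup F] [NormedSpace ℝ F]
    (V : ∀ x : N, TangentSpace 𝓘(ℝ, Model d) x) (f : N → F) (x : N) : F :=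
  mfderiv 𝓘(ℝ, Model d) 𝓘(ℝ, F) f x (V x)

/-- The transition map between the preferred charts around two points. -/
def chartTransition (i j : N) : Model d → Model d :=
  extChartAt 𝓘(ℝ, Model d) j ∘ (extChartAt 𝓘(ℝ, Model d) i).symm

theorem symm_chartTransition {i j : N} {y : Model d}
    (hj : (extChartAt 𝓘(ℝ, Model d) i).symm y ∈ (extChartAt 𝓘(ℝ, Model d) j).source) :
    (extChartAt 𝓘(ℝ, Model d) j).symm (chartTransition i j y) =
      (extChartAt 𝓘(ℝ, Model d) i).symm y :=
  (extChartAt 𝓘(ℝ, Model d) j).left_inv hj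

/-- The density of a volume form in the preferred chart around a point. -/
def VolForm.density (ν : VolForm d N) (i : N) (y : Model d) : ℝ :=
  formInChart ν.form i y (stdBasis d)

theorem VolForm.contDiffOn_density (ν : VolForm d N) (i : N) :
    ContDiffOn ℝ ∞ (ν.density i) (extChartAt 𝓘(ℝ, Model d) i).target :=
  (ContinuousAlternatingMap.apply ℝ (Model d) ℝ (stdBasis d)).contDiff.comp_contDiffOn (ν.smooth i)

variable [IsManifold 𝓘(ℝ, Model d) ∞ N]

theorem contMDiffAt_extChartAt_symm_of_mem (i : N) {y : Model d}
    (hy : y ∈ (extChartAt 𝓘(ℝ, Model d) i).target) :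
    ContMDiffAt 𝓘(ℝ, Model d) 𝓘(ℝ, Model d) ∞ (extChartAt 𝓘(ℝ, Model d) i).symm y :=
  (contMDiffOn_extChartAt_symm i).contMDiffAt ((isOpen_extChartAt_target i).mem_nhds hy)

theorem isInvertible_mfderiv_extChartAt_symm_of_mem (i : N) {y : Model d}
    (hy : y ∈ (extChartAt 𝓘(ℝ, Model d) i).target) :
    (mfderiv 𝓘(ℝ, Model d) 𝓘(ℝ, Model d) (extChartAt 𝓘(ℝ, Model d) i).symm y).IsInvertible := by
  have : IsManifold 𝓘(ℝ, Model d) 1 N := IsManifold.of_le (n := ∞) (by simp)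
  have h := isInvertible_mfderivWithin_extChartAt_symm (I := 𝓘(ℝ, Model d)) hy
  rwa [modelWithCornersSelf_coe, range_id, mfderivWithin_univ] at h

theorem contDiffOn_fieldInChart {V : ∀ x : N, TangentSpace 𝓘(ℝ, Model d) x}
    (hV : ContMDiff 𝓘(ℝ, Model d) (𝓘(ℝ, Model d).prod 𝓘(ℝ, Model d)) ∞
      (fun x => (⟨x, V x⟩ : TangentBundle 𝓘(ℝ, Model d) N))) (i : N) :
    ContDiffOn ℝ ∞ (fieldInChart V i) (extChartAt 𝓘(ℝ, Model d) i).target := by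
  intro y hy
  have : IsManifold 𝓘(ℝ, Model d) (∞ + 1) N := inferInstanceAs (IsManifold 𝓘(ℝ, Model d) ∞ N)
  refine ContDiffAt.contDiffWithinAt ?_
  exact contMDiffAt_vectorSpace_iff_contDiffAt.1 (ContMDiffAt.mpullback_vectorField_preimage
    (hV _) (contMDiffAt_extChartAt_symm_of_mem i hy)
    (isInvertible_mfderiv_extChartAt_symm_of_mem i hy) (by simp))

theorem mfderiv_extChartAt_symm_fieldInChart (V : ∀ x : N, TangentSpace 𝓘(ℝ, Model d) x) (i : N)
    {y : Model d} (hy : y ∈ (extChartAt 𝓘(ℝ, Model d) i).target) :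
    mfderiv 𝓘(ℝ, Model d) 𝓘(ℝ, Model d) (extChartAt 𝓘(ℝ, Model d) i).symm y
      (fieldInChart V i y) = V ((extChartAt 𝓘(ℝ, Model d) i).symm y) := by
  rw [fieldInChart, mpullback_apply]
  exact (isInvertible_mfderiv_extChartAt_symm_of_mem i hy).self_apply_inverse _

theorem derivAlong_symm {F : Type*} [NormedAddCommGroup F] [NormedSpace ℝ F] {f : N → F}
    (V : ∀ x : N, TangentSpace 𝓘(ℝ, Model d) x) (i : N)
    {y : Model d} (hy : y ∈ (extChartAt 𝓘(ℝ, Model d) i).target)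
    (hf : MDifferentiableAt 𝓘(ℝ, Model d) 𝓘(ℝ, F) f ((extChartAt 𝓘(ℝ, Model d) i).symm y)) :
    derivAlong V f ((extChartAt 𝓘(ℝ, Model d) i).symm y) =
      fderiv ℝ (f ∘ (extChartAt 𝓘(ℝ, Model d) i).symm) y (fieldInChart V i y) := by
  rw [derivAlong, ← mfderiv_extChartAt_symm_fieldInChart V i hy, ← mfderiv_eq_fderiv, mfderiv_comp y hf
    ((contMDiffAt_extChartAt_symm_of_mem i hy).mdifferentiableAt (by simp))]
  rfl

theorem contDiffAt_chartTransition {i j : N} {y : Model d}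
    (hy : y ∈ (extChartAt 𝓘(ℝ, Model d) i).target)
    (hj : (extChartAt 𝓘(ℝ, Model d) i).symm y ∈ (extChartAt 𝓘(ℝ, Model d) j).source) :
    ContDiffAt ℝ ∞ (chartTransition i j) y := by
  rw [extChartAt_source] at hj
  exact ((contMDiffAt_extChartAt' hj).comp y (contMDiffAt_extChartAt_symm_of_mem i hy)).contDiffAt

theorem eventually_mem_target_and_source {i j : N} {y : Model d}
    (hy : y ∈ (extChartAt 𝓘(ℝ, Model d) i).target)
    (hj : (extChartAt 𝓘(ℝ, Model d) i).symm y ∈ (extChartAt 𝓘(ℝ, Model d) j).source) :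
    ∀ᶠ z in 𝓝 y, z ∈ (extChartAt 𝓘(ℝ, Model d) i).target ∧
      (extChartAt 𝓘(ℝ, Model d) i).symm z ∈ (extChartAt 𝓘(ℝ, Model d) j).source :=
  ((isOpen_extChartAt_target i).mem_nhds hy |> Filter.Eventually.and <|
    (contMDiffAt_extChartAt_symm_of_mem i hy).continuousAt
      ((isOpen_extChartAt_source j).mem_nhds hj))

/-- Chain rule for the identity between the inverse of chart `i` and the inverse of chart `j` after
the transition map, valid near `y`. The transformation laws of fields and of forms both follow from
it. -/
theorem chartSymmDeriv_comp_fderiv_chartTransition {i j : N} {y : Model d}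
    (hy : y ∈ (extChartAt 𝓘(ℝ, Model d) i).target)
    (hj : (extChartAt 𝓘(ℝ, Model d) i).symm y ∈ (extChartAt 𝓘(ℝ, Model d) j).source) :
    chartSymmDeriv j (chartTransition i j y) ∘L fderiv ℝ (chartTransition i j) y =
      chartSymmDeriv i y := by
  have hτ := contDiffAt_chartTransition hy hj
  have ht : chartTransition i j y ∈ (extChartAt 𝓘(ℝ, Model d) j).target :=
    (extChartAt 𝓘(ℝ, Model d) j).map_source hj
  have h := mfderiv_comp y
    ((contMDiffAt_extChartAt_symm_of_mem j ht).mdifferentiableAt (by simp))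
    (hτ.contMDiffAt.mdifferentiableAt (by simp))
  have e : (extChartAt 𝓘(ℝ, Model d) j).symm ∘ chartTransition i j =ᶠ[𝓝 y]
      (extChartAt 𝓘(ℝ, Model d) i).symm := by
    filter_upwards [eventually_mem_target_and_source hy hj] with z hz
    exact (extChartAt 𝓘(ℝ, Model d) j).left_inv hz.2
  have e' := e.mfderiv_eq (I := 𝓘(ℝ, Model d)) (I' := 𝓘(ℝ, Model d))
  rw [← mfderiv_eq_fderiv]
  exact h.symm.trans e'

/-- Together with `formInChart_chartTransition` this supplies the hypotheses `eW` and `eη` of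
`lieDerivCoord_comp` for a transition map. -/
theorem fieldInChart_chartTransition (V : ∀ x : N, TangentSpace 𝓘(ℝ, Model d) x) {i j : N}
    {y : Model d} (hy : y ∈ (extChartAt 𝓘(ℝ, Model d) i).target)
    (hj : (extChartAt 𝓘(ℝ, Model d) i).symm y ∈ (extChartAt 𝓘(ℝ, Model d) j).source) :
    fieldInChart V j (chartTransition i j y) =
      fderiv ℝ (chartTransition i j) y (fieldInChart V i y) := by
  have ht : chartTransition i j y ∈ (extChartAt 𝓘(ℝ, Model d) j).target :=
    (extChartAt 𝓘(ℝ, Model d) j).map_source hj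
  rw [fieldInChart, mpullback_apply]
  refine (isInvertible_mfderiv_extChartAt_symm_of_mem j ht).inverse_apply_eq.2 ?_
  have h1 : (V ((extChartAt 𝓘(ℝ, Model d) j).symm (chartTransition i j y)) : Model d) =
      V ((extChartAt 𝓘(ℝ, Model d) i).symm y) :=
    congrArg (fun p => (V p : Model d)) (symm_chartTransition hj)
  have h2 := congrArg (fun T : Model d →L[ℝ] Model d => T (fieldInChart V i y))
    (chartSymmDeriv_comp_fderiv_chartTransition hy hj)
  exact h1.trans ((mfderiv_extChartAt_symm_fieldInChart V i hy).symm.trans h2.symm)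

theorem formInChart_chartTransition (ν : ∀ x : N, TangentSpace 𝓘(ℝ, Model d) x [⋀^Fin d]→L[ℝ] ℝ)
    {i j : N} {y : Model d} (hy : y ∈ (extChartAt 𝓘(ℝ, Model d) i).target)
    (hj : (extChartAt 𝓘(ℝ, Model d) i).symm y ∈ (extChartAt 𝓘(ℝ, Model d) j).source) :
    formInChart ν i y = (formInChart ν j (chartTransition i j y)).compContinuousLinearMap
      (fderiv ℝ (chartTransition i j) y) := by
  have h1 : (ν ((extChartAt 𝓘(ℝ, Model d) j).symm (chartTransition i j y)) :
      Model d [⋀^Fin d]→L[ℝ] ℝ) = ν ((extChartAt 𝓘(ℝ, Model d) i).symm y) :=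
    congrArg (fun p : N => show Model d [⋀^Fin d]→L[ℝ] ℝ from ν p) (symm_chartTransition hj)
  have h2 := congrArg (fun T : Model d →L[ℝ] Model d =>
    (show Model d [⋀^Fin d]→L[ℝ] ℝ from
      ν ((extChartAt 𝓘(ℝ, Model d) i).symm y)).compContinuousLinearMap T)
    (chartSymmDeriv_comp_fderiv_chartTransition hy hj)
  refine h2.symm.trans ?_
  exact congrArg (fun η : Model d [⋀^Fin d]→L[ℝ] ℝ => η.compContinuousLinearMap
    (chartSymmDeriv j (chartTransition i j y) ∘L fderiv ℝ (chartTransition i j) y)) h1.symm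

/-- The tangent space at `x` is identified with the model through the preferred chart at `x`, so the
derivative of that chart and of its inverse at the base point is the identity. -/
theorem formInChart_self (ν : ∀ x : N, TangentSpace 𝓘(ℝ, Model d) x [⋀^Fin d]→L[ℝ] ℝ) (x : N) :
    formInChart ν x (extChartAt 𝓘(ℝ, Model d) x x) = ν x := by
  have : IsManifold 𝓘(ℝ, Model d) 1 N := IsManifold.of_le (n := ∞) (by simp)
  have h := mfderivWithin_range_extChartAt_symm (I := 𝓘(ℝ, Model d)) (x := x)
  rw [modelWithCornersSelf_coe, range_id, mfderivWithin_univ] at h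
  have h1 : (ν ((extChartAt 𝓘(ℝ, Model d) x).symm (extChartAt 𝓘(ℝ, Model d) x x)) :
      Model d [⋀^Fin d]→L[ℝ] ℝ) = ν x :=
    congrArg (fun p : N => show Model d [⋀^Fin d]→L[ℝ] ℝ from ν p) (extChartAt_to_inv x)
  exact (congrArg (fun T : Model d →L[ℝ] Model d => (show Model d [⋀^Fin d]→L[ℝ] ℝ from
    ν ((extChartAt 𝓘(ℝ, Model d) x).symm
      (extChartAt 𝓘(ℝ, Model d) x x))).compContinuousLinearMap T) h).trans h1

theorem lieDeriv_self (V : ∀ x : N, TangentSpace 𝓘(ℝ, Model d) x)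
    (ν : ∀ x : N, TangentSpace 𝓘(ℝ, Model d) x [⋀^Fin d]→L[ℝ] ℝ) (x : N) :
    lieDeriv V ν x = lieDerivCoord (fieldInChart V x) (formInChart ν x)
      (extChartAt 𝓘(ℝ, Model d) x x) := by
  have : IsManifold 𝓘(ℝ, Model d) 1 N := IsManifold.of_le (n := ∞) (by simp)
  exact congrArg (fun T : Model d →L[ℝ] Model d => (lieDerivCoord (fieldInChart V x)
    (formInChart ν x) (extChartAt 𝓘(ℝ, Model d) x x)).compContinuousLinearMap T)
    (mfderiv_extChartAt_self (I := 𝓘(ℝ, Model d)) (x := x))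

/-- The derivative of the inverse chart is invertible, so a form with zero pull-back would itself
vanish. -/
theorem VolForm.density_ne_zero (ν : VolForm d N) (i : N) {y : Model d}
    (hy : y ∈ (extChartAt 𝓘(ℝ, Model d) i).target) : ν.density i y ≠ 0 := by
  refine stdBasis_ne_zero fun h => ν.ne_zero ((extChartAt 𝓘(ℝ, Model d) i).symm y) ?_
  have hS : (chartSymmDeriv i y).IsInvertible := isInvertible_mfderiv_extChartAt_symm_of_mem i hy
  obtain ⟨e, he⟩ := hS
  ext v
  have h1 : (ν.form ((extChartAt 𝓘(ℝ, Model d) i).symm y))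
      (fun k => chartSymmDeriv i y (e.symm (v k))) = 0 :=
    congrArg (fun η : Model d [⋀^Fin d]→L[ℝ] ℝ => η (fun k => e.symm (v k))) h
  have h2 : (fun k => chartSymmDeriv i y (e.symm (v k))) = v := by
    funext k
    rw [← he]
    exact e.apply_symm_apply _
  exact (congrArg (ν.form ((extChartAt 𝓘(ℝ, Model d) i).symm y)) h2).symm.trans h1

theorem VolForm.density_chartTransition (ν : VolForm d N) {i j : N} {y : Model d}
    (hy : y ∈ (extChartAt 𝓘(ℝ, Model d) i).target)
    (hj : (extChartAt 𝓘(ℝ, Model d) i).symm y ∈ (extChartAt 𝓘(ℝ, Model d) j).source) :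
    ν.density i y =
      (fderiv ℝ (chartTransition i j) y).det * ν.density j (chartTransition i j y) := by
  rw [density, formInChart_chartTransition ν.form hy hj, compContinuousLinearMap_stdBasis]
  rfl

variable {V : ∀ x : N, TangentSpace 𝓘(ℝ, Model d) x}

/-- By definition the divergence at `x` is read off in the chart centred at `x`, which moves with
`x`. Pulling back the identity `L_V ν = (div V) ν` by the transition map transfers it to the fixed
chart `i`, where evaluation on the standard basis and division by the nonzero density give the
formula. -/
theorem divergence_symm (ν : VolForm d N)
    (hV : ContMDiff 𝓘(ℝ, Model d) (𝓘(ℝ, Model d).prod 𝓘(ℝ, Model d)) ∞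
      (fun x => (⟨x, V x⟩ : TangentBundle 𝓘(ℝ, Model d) N))) (i : N) {y : Model d}
    (hy : y ∈ (extChartAt 𝓘(ℝ, Model d) i).target) :
    divergence ν V ((extChartAt 𝓘(ℝ, Model d) i).symm y) =
      densityDiv (ν.density i) (fieldInChart V i) y := by
  set x := (extChartAt 𝓘(ℝ, Model d) i).symm y with hx
  have hj : (extChartAt 𝓘(ℝ, Model d) i).symm y ∈ (extChartAt 𝓘(ℝ, Model d) x).source :=
    mem_extChartAt_source x
  have ht : chartTransition i x y ∈ (extChartAt 𝓘(ℝ, Model d) x).target :=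
    (extChartAt 𝓘(ℝ, Model d) x).map_source hj
  have hxy : extChartAt 𝓘(ℝ, Model d) x x = chartTransition i x y := rfl
  have dat : ∀ {F : Type} [NormedAddCommGroup F] [NormedSpace ℝ F] {g : Model d → F} {j : N}
      {z : Model d}, ContDiffOn ℝ ∞ g (extChartAt 𝓘(ℝ, Model d) j).target →
      z ∈ (extChartAt 𝓘(ℝ, Model d) j).target → DifferentiableAt ℝ g z := fun hg hz =>
    (hg.contDiffAt ((isOpen_extChartAt_target _).mem_nhds hz)).differentiableAt (by simp)
  have h := lieDerivCoord_comp (W := fieldInChart V i) (W' := fieldInChart V x)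
    (η := formInChart ν.form i) (η' := formInChart ν.form x)
    ((contDiffAt_chartTransition hy hj).of_le (by norm_cast))
    (dat (contDiffOn_fieldInChart hV i) hy) (dat (contDiffOn_fieldInChart hV x) ht)
    (dat (ν.smooth x) ht)
    ((eventually_mem_target_and_source hy hj).mono fun z hz =>
      fieldInChart_chartTransition V hz.1 hz.2)
    ((eventually_mem_target_and_source hy hj).mono fun z hz =>
      formInChart_chartTransition ν.form hz.1 hz.2)
  have h1 := (lieDeriv_self V ν.form x).symm.trans (lieDeriv_eq ν V x)
  have h2 : lieDerivCoord (fieldInChart V x) (formInChart ν.form x) (chartTransition i x y) =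
      divergence ν V x • formInChart ν.form x (chartTransition i x y) :=
    h1.trans (congrArg (fun η : Model d [⋀^Fin d]→L[ℝ] ℝ => divergence ν V x • η)
      (formInChart_self ν.form x).symm)
  have h3 : lieDerivCoord (fieldInChart V i) (formInChart ν.form i) y =
      divergence ν V x • formInChart ν.form i y := by
    rw [h, h2, formInChart_chartTransition ν.form hy hj]
    rfl
  have h4 := lieDerivCoord_stdBasis (W := fieldInChart V i) (dat (ν.smooth i) hy)
    (ν.density_ne_zero i hy)
  rw [h3] at h4
  exact mul_right_cancel₀ (ν.density_ne_zero i hy) h4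

theorem contDiffOn_densityDiv_fieldInChart (ν : VolForm d N)
    (hV : ContMDiff 𝓘(ℝ, Model d) (𝓘(ℝ, Model d).prod 𝓘(ℝ, Model d)) ∞
      (fun x => (⟨x, V x⟩ : TangentBundle 𝓘(ℝ, Model d) N))) (i : N) :
    ContDiffOn ℝ ∞ (densityDiv (ν.density i) (fieldInChart V i))
      (extChartAt 𝓘(ℝ, Model d) i).target := fun y hy => by
  have n := (isOpen_extChartAt_target (I := 𝓘(ℝ, Model d)) i).mem_nhds hy
  exact (contDiffAt_densityDiv (m := ∞) ((ν.contDiffOn_density i).contDiffAt n)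
    ((contDiffOn_fieldInChart hV i).contDiffAt n) (ν.density_ne_zero i hy)).contDiffWithinAt

theorem contMDiff_divergence (ν : VolForm d N)
    (hV : ContMDiff 𝓘(ℝ, Model d) (𝓘(ℝ, Model d).prod 𝓘(ℝ, Model d)) ∞
      (fun x => (⟨x, V x⟩ : TangentBundle 𝓘(ℝ, Model d) N))) :
    ContMDiff 𝓘(ℝ, Model d) 𝓘(ℝ, ℝ) ∞ (divergence ν V) := by
  intro x
  have h1 := (contDiffOn_densityDiv_fieldInChart ν hV x).contDiffAt
    ((isOpen_extChartAt_target (I := 𝓘(ℝ, Model d)) x).mem_nhds (mem_extChartAt_target x))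
  refine (h1.contMDiffAt.comp x contMDiffAt_extChartAt).congr_of_eventuallyEq ?_
  filter_upwards [extChartAt_source_mem_nhds (I := 𝓘(ℝ, Model d)) x] with z hz
  have := divergence_symm ν hV x ((extChartAt 𝓘(ℝ, Model d) x).map_source hz)
  rwa [(extChartAt 𝓘(ℝ, Model d) x).left_inv hz] at this

theorem continuous_derivAlong {F : Type*} [NormedAddCommGroup F] [NormedSpace ℝ F] {f : N → F}
    (hf : ContMDiff 𝓘(ℝ, Model d) 𝓘(ℝ, F) 1 f)
    (hV : ContMDiff 𝓘(ℝ, Model d) (𝓘(ℝ, Model d).prod 𝓘(ℝ, Model d)) ∞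
      (fun x => (⟨x, V x⟩ : TangentBundle 𝓘(ℝ, Model d) N))) :
    Continuous (derivAlong V f) := by
  refine continuous_iff_continuousAt.2 fun x => ?_
  have n := (isOpen_extChartAt_target (I := 𝓘(ℝ, Model d)) x).mem_nhds (mem_extChartAt_target x)
  have h1 : ContDiffAt ℝ 1 (f ∘ (extChartAt 𝓘(ℝ, Model d) x).symm)
      (extChartAt 𝓘(ℝ, Model d) x x) :=
    ((hf _).comp _ ((contMDiffAt_extChartAt_symm_of_mem x
      (mem_extChartAt_target x)).of_le (by simp))).contDiffAt
  have h2 : ContinuousAt (fun y => fderiv ℝ (f ∘ (extChartAt 𝓘(ℝ, Model d) x).symm) y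
      (fieldInChart V x y)) (extChartAt 𝓘(ℝ, Model d) x x) :=
    (h1.fderiv_right (m := 0) (by simp)).continuousAt.clm_apply
      ((contDiffOn_fieldInChart hV x).contDiffAt n).continuousAt
  refine (h2.comp (continuousAt_extChartAt x)).congr ?_
  filter_upwards [extChartAt_source_mem_nhds (I := 𝓘(ℝ, Model d)) x] with z hz
  have := derivAlong_symm (f := f) V x ((extChartAt 𝓘(ℝ, Model d) x).map_source hz)
    ((hf _).mdifferentiableAt one_ne_zero)
  rw [(extChartAt 𝓘(ℝ, Model d) x).left_inv hz] at this
  exact this.symm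

theorem fieldInChart_mlieBracket {X Y : ∀ x : N, TangentSpace 𝓘(ℝ, Model d) x}
    (hX : ContMDiff 𝓘(ℝ, Model d) (𝓘(ℝ, Model d).prod 𝓘(ℝ, Model d)) ∞
      (fun x => (⟨x, X x⟩ : TangentBundle 𝓘(ℝ, Model d) N)))
    (hY : ContMDiff 𝓘(ℝ, Model d) (𝓘(ℝ, Model d).prod 𝓘(ℝ, Model d)) ∞
      (fun x => (⟨x, Y x⟩ : TangentBundle 𝓘(ℝ, Model d) N))) (i : N) {y : Model d}
    (hy : y ∈ (extChartAt 𝓘(ℝ, Model d) i).target) :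
    fieldInChart (mlieBracket 𝓘(ℝ, Model d) X Y) i y =
      lieBracket ℝ (fieldInChart X i) (fieldInChart Y i) y := by
  have : IsManifold 𝓘(ℝ, Model d) (minSmoothness ℝ 2) N :=
    IsManifold.of_le (n := ∞) (by rw [minSmoothness_of_isRCLikeNormedField]; norm_cast)
  have h := mpullback_mlieBracket (I := 𝓘(ℝ, Model d)) (n := ∞)
    ((hX _).mdifferentiableAt (by simp)) ((hY _).mdifferentiableAt (by simp))
    (contMDiffAt_extChartAt_symm_of_mem i hy)
    (by rw [minSmoothness_of_isRCLikeNormedField]; norm_cast)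
  refine h.trans ?_
  rw [← mlieBracketWithin_univ, mlieBracketWithin_eq_lieBracketWithin]
  exact congrFun lieBracketWithin_univ y

/-- The identity is local: in one chart all three divergences become `densityDiv` and the bracket
becomes the coordinate bracket, so `densityDiv_lieBracket` applies. Smoothness of the bracket enters
through `divergence_symm`. -/
theorem divergence_mlieBracket (ν : VolForm d N) {X Y : ∀ x : N, TangentSpace 𝓘(ℝ, Model d) x}
    (hX : ContMDiff 𝓘(ℝ, Model d) (𝓘(ℝ, Model d).prod 𝓘(ℝ, Model d)) ∞
      (fun x => (⟨x, X x⟩ : TangentBundle 𝓘(ℝ, Model d) N)))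
    (hY : ContMDiff 𝓘(ℝ, Model d) (𝓘(ℝ, Model d).prod 𝓘(ℝ, Model d)) ∞
      (fun x => (⟨x, Y x⟩ : TangentBundle 𝓘(ℝ, Model d) N)))
    (hXY : ContMDiff 𝓘(ℝ, Model d) (𝓘(ℝ, Model d).prod 𝓘(ℝ, Model d)) ∞
      (fun x => (⟨x, mlieBracket 𝓘(ℝ, Model d) X Y x⟩ : TangentBundle 𝓘(ℝ, Model d) N))) (x : N) :
    divergence ν (mlieBracket 𝓘(ℝ, Model d) X Y) x =
      derivAlong X (divergence ν Y) x - derivAlong Y (divergence ν X) x := by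
  obtain ⟨i, y, hy, rfl⟩ : ∃ i : N, ∃ y ∈ (extChartAt 𝓘(ℝ, Model d) i).target,
      (extChartAt 𝓘(ℝ, Model d) i).symm y = x :=
    ⟨x, _, mem_extChartAt_target x, extChartAt_to_inv x⟩
  have n := (isOpen_extChartAt_target (I := 𝓘(ℝ, Model d)) i).mem_nhds hy
  have c2 : ∀ {F : Type} [NormedAddCommGroup F] [NormedSpace ℝ F] {g : Model d → F},
      ContDiffOn ℝ ∞ g (extChartAt 𝓘(ℝ, Model d) i).target → ContDiffAt ℝ 2 g y :=
    fun hg => (hg.contDiffAt n).of_le (by norm_cast)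
  have e : ∀ {Z Z' : ∀ x : N, TangentSpace 𝓘(ℝ, Model d) x},
      ContMDiff 𝓘(ℝ, Model d) (𝓘(ℝ, Model d).prod 𝓘(ℝ, Model d)) ∞
      (fun x => (⟨x, Z x⟩ : TangentBundle 𝓘(ℝ, Model d) N)) →
      derivAlong Z' (divergence ν Z) ((extChartAt 𝓘(ℝ, Model d) i).symm y) =
        fderiv ℝ (densityDiv (ν.density i) (fieldInChart Z i)) y (fieldInChart Z' i y) := by
    intro Z Z' hZ
    refine (derivAlong_symm Z' i hy
      ((contMDiff_divergence ν hZ _).mdifferentiableAt (by simp))).trans ?_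
    have : divergence ν Z ∘ (extChartAt 𝓘(ℝ, Model d) i).symm =ᶠ[𝓝 y]
        densityDiv (ν.density i) (fieldInChart Z i) := by
      filter_upwards [n] with z hz
      exact divergence_symm ν hZ i hz
    rw [this.fderiv_eq]
  have eb : fieldInChart (mlieBracket 𝓘(ℝ, Model d) X Y) i =ᶠ[𝓝 y]
      lieBracket ℝ (fieldInChart X i) (fieldInChart Y i) := by
    filter_upwards [n] with z hz
    exact fieldInChart_mlieBracket hX hY i hz
  rw [divergence_symm ν hXY i hy, e hY, e hX, ← densityDiv_lieBracket
    (c2 (ν.contDiffOn_density i)) (c2 (contDiffOn_fieldInChart hX i))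
    (c2 (contDiffOn_fieldInChart hY i)) (ν.density_ne_zero i hy), densityDiv, densityDiv,
    eb.fderiv_eq, eb.self_of_nhds]

end Charts

/-! ### The measure of a volume form and the divergence theorem -/

section Measure

/-- Inverse charts are controlled only on their target, so `g` is merely almost everywhere
measurable for the restricted measure. -/
theorem lintegral_map_withDensity_restrict {E N : Type*} [TopologicalSpace E] [MeasurableSpace E]
    [BorelSpace E] [TopologicalSpace N] [MeasurableSpace N] [BorelSpace N] {m : Measure E}
    {T : Set E} (hT : MeasurableSet T) {g : E → N} (hg : ContinuousOn g T) {w : E → ENNReal}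
    (hw : AEMeasurable w (m.restrict T)) {f : N → ENNReal} (hf : Measurable f) :
    ∫⁻ x, f x ∂(((m.restrict T).withDensity w).map g) = ∫⁻ y in T, w y * f (g y) ∂m := by
  have hg' : AEMeasurable g (m.restrict T) := hg.aemeasurable hT
  rw [lintegral_map' hf.aemeasurable (hg'.mono_ac (withDensity_absolutelyContinuous _ _))]
  exact lintegral_withDensity_eq_lintegral_mul₀ hw (hf.comp_aemeasurable hg')

variable {d : ℕ} {N : Type*} [TopologicalSpace N] [ChartedSpace (Model d) N]

theorem derivAlong_add {V : ∀ x : N, TangentSpace 𝓘(ℝ, Model d) x} {f g : N → ℂ} (hf : ContMDiff 𝓘(ℝ, Model d) 𝓘(ℝ, ℂ) 1 f)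
    (hg : ContMDiff 𝓘(ℝ, Model d) 𝓘(ℝ, ℂ) 1 g) (x : N) :
    derivAlong V (f + g) x = derivAlong V f x + derivAlong V g x := by
  unfold derivAlong
  rw [mfderiv_add ((hf x).mdifferentiableAt one_ne_zero) ((hg x).mdifferentiableAt one_ne_zero)]
  rfl

theorem derivAlong_mul {V : ∀ x : N, TangentSpace 𝓘(ℝ, Model d) x} {f g : N → ℂ} (hf : ContMDiff 𝓘(ℝ, Model d) 𝓘(ℝ, ℂ) 1 f)
    (hg : ContMDiff 𝓘(ℝ, Model d) 𝓘(ℝ, ℂ) 1 g) (x : N) :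
    derivAlong V (f * g) x = f x * derivAlong V g x + g x * derivAlong V f x := by
  unfold derivAlong
  rw [(((hf x).mdifferentiableAt one_ne_zero).hasMFDerivAt.mul
    ((hg x).mdifferentiableAt one_ne_zero).hasMFDerivAt).mfderiv]
  rfl

theorem contMDiff_mul_complex {f g : N → ℂ} (hf : ContMDiff 𝓘(ℝ, Model d) 𝓘(ℝ, ℂ) 1 f)
    (hg : ContMDiff 𝓘(ℝ, Model d) 𝓘(ℝ, ℂ) 1 g) : ContMDiff 𝓘(ℝ, Model d) 𝓘(ℝ, ℂ) 1 (f * g) :=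
  (contDiff_mul (𝕜 := ℝ) (𝔸 := ℂ)).contMDiff.comp (hf.prodMk_space hg)

theorem VolForm.aemeasurable_density (ν : VolForm d N) (i : N) :
    AEMeasurable (fun y => ENNReal.ofReal |ν.density i y|)
      (volume.restrict (extChartAt 𝓘(ℝ, Model d) i).target) :=
  ((ν.contDiffOn_density i).continuousOn.abs.aemeasurable
    (isOpen_extChartAt_target i).measurableSet).ennreal_ofReal

variable [IsManifold 𝓘(ℝ, Model d) ∞ N]

/-- Change of variables between two charts. -/
theorem VolForm.lintegral_chartTransition (ν : VolForm d N) (i j : N) (f : N → ENNReal) :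
    ∫⁻ y in (extChartAt 𝓘(ℝ, Model d) i).target ∩ (extChartAt 𝓘(ℝ, Model d) i).symm ⁻¹'
        (extChartAt 𝓘(ℝ, Model d) j).source,
      ENNReal.ofReal |ν.density i y| * f ((extChartAt 𝓘(ℝ, Model d) i).symm y) =
    ∫⁻ y in (extChartAt 𝓘(ℝ, Model d) j).target ∩ (extChartAt 𝓘(ℝ, Model d) j).symm ⁻¹'
        (extChartAt 𝓘(ℝ, Model d) i).source,
      ENNReal.ofReal |ν.density j y| * f ((extChartAt 𝓘(ℝ, Model d) j).symm y) := by
  set U : N → N → Set (Model d) := fun i j => (extChartAt 𝓘(ℝ, Model d) i).target ∩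
    (extChartAt 𝓘(ℝ, Model d) i).symm ⁻¹' (extChartAt 𝓘(ℝ, Model d) j).source with hU
  have maps : ∀ i j, MapsTo (chartTransition i j) (U i j) (U j i) := fun i j y hy =>
    ⟨(extChartAt 𝓘(ℝ, Model d) j).map_source hy.2, by
      rw [mem_preimage, symm_chartTransition hy.2]
      exact (extChartAt 𝓘(ℝ, Model d) i).map_target hy.1⟩
  have inv : ∀ i j, ∀ y ∈ U i j, chartTransition j i (chartTransition i j y) = y :=
    fun i j y hy => by
      rw [chartTransition, Function.comp_apply, symm_chartTransition hy.2]
      exact (extChartAt 𝓘(ℝ, Model d) i).right_inv hy.1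
  -- The overlap seen in chart `i` is the image of the overlap seen in chart `j`, so the integral is
  -- substituted along the transition from `j` to `i`.
  have image : U i j = chartTransition j i '' U j i := Subset.antisymm
    (fun y hy => ⟨_, maps i j hy, inv i j y hy⟩) (image_subset_iff.2 (maps j i))
  have open_U : IsOpen (U j i) := (continuousOn_extChartAt_symm j).isOpen_inter_preimage
    (isOpen_extChartAt_target j) (isOpen_extChartAt_source i)
  change ∫⁻ y in U i j, _ = ∫⁻ y in U j i, _
  rw [image, lintegral_image_eq_lintegral_abs_det_fderiv_mul volume open_U.measurableSet
    (fun y hy => ((contDiffAt_chartTransition hy.1 hy.2).differentiableAt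
      (by simp)).hasFDerivAt.hasFDerivWithinAt) (LeftInvOn.injOn fun y hy => inv j i y hy)]
  refine setLIntegral_congr_fun open_U.measurableSet fun y hy => ?_
  -- The Jacobian of the substitution is exactly the factor between the two densities.
  rw [symm_chartTransition hy.2, ν.density_chartTransition hy.1 hy.2, abs_mul,
    ENNReal.ofReal_mul (abs_nonneg _), mul_assoc]

variable [CompactSpace N] [T2Space N]

theorem finite_nonempty_support_chartPartition :
    {i : N | (Function.support (chartPartition d N i)).Nonempty}.Finite :=
  (chartPartition d N).locallyFinite.finite_nonempty_of_compact

variable (d N) in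
/-- The finite set of indices of the nonzero members of the partition of unity. -/
def partitionIndices : Finset N :=
  (finite_nonempty_support_chartPartition (d := d) (N := N)).toFinset

theorem chartPartition_eq_zero_of_notMem {i : N} (hi : i ∉ partitionIndices d N) (x : N) :
    chartPartition d N i x = 0 := by
  by_contra hne
  exact hi ((finite_nonempty_support_chartPartition (d := d) (N := N)).mem_toFinset.2 ⟨x, hne⟩)

theorem sum_chartPartition (x : N) :
    ∑ i ∈ partitionIndices d N, chartPartition d N i x = 1 := by
  rw [← (chartPartition d N).sum_eq_one (mem_univ x)]
  refine (finsum_eq_sum_of_support_subset _ fun i hi => ?_).symm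
  by_contra h
  exact hi (chartPartition_eq_zero_of_notMem h x)

theorem chartPartition_eq_zero {i x : N} (hx : x ∉ (extChartAt 𝓘(ℝ, Model d) i).source) :
    chartPartition d N i x = 0 := by
  by_contra hne
  rw [extChartAt_source] at hx
  exact hx (chartPartition_subordinate i (subset_tsupport _ hne))

variable [MeasurableSpace N] [BorelSpace N]

/-- On the domain of a chart the measure of a volume form is given by its density. -/
theorem VolForm.restrict_measure (ν : VolForm d N) (j : N) :
    ν.measure.restrict (extChartAt 𝓘(ℝ, Model d) j).source =
      ((volume.restrict (extChartAt 𝓘(ℝ, Model d) j).target).withDensity fun y =>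
        ENNReal.ofReal |ν.density j y|).map (extChartAt 𝓘(ℝ, Model d) j).symm := by
  ext A hA
  have hTm : ∀ i : N, MeasurableSet (extChartAt 𝓘(ℝ, Model d) i).target := fun i =>
    (isOpen_extChartAt_target i).measurableSet
  have hSm : ∀ i : N, MeasurableSet (extChartAt 𝓘(ℝ, Model d) i).source := fun i =>
    (isOpen_extChartAt_source i).measurableSet
  have hρ : ∀ i j : N, AEMeasurable
      (fun y => ENNReal.ofReal (chartPartition d N i ((extChartAt 𝓘(ℝ, Model d) j).symm y)))
      (volume.restrict (extChartAt 𝓘(ℝ, Model d) j).target) := fun i j =>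
    (((chartPartition d N i).contMDiff.continuous.comp_continuousOn
      (continuousOn_extChartAt_symm j)).aemeasurable (hTm j)).ennreal_ofReal
  have hAm : Measurable (A.indicator (1 : N → ENNReal)) := measurable_one.indicator hA
  -- Each piece of the measure, cut down to the domain of chart `j`, is rewritten as an integral in
  -- chart `j` still weighted by the `i`-th bump function. Both sides live on the overlap of the
  -- charts: on the left because of the indicator (`e1`), on the right because the bump function
  -- vanishes off chart `i` (`e2`).
  have step : ∀ i : N,
      ∫⁻ x, (extChartAt 𝓘(ℝ, Model d) j).source.indicator (A.indicator 1) x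
        ∂(((volume.restrict (extChartAt 𝓘(ℝ, Model d) i).target).withDensity fun y =>
          ENNReal.ofReal (chartPartition d N i ((extChartAt 𝓘(ℝ, Model d) i).symm y) *
            |formInChart ν.form i y (stdBasis d)|)).map (extChartAt 𝓘(ℝ, Model d) i).symm) =
      ∫⁻ y in (extChartAt 𝓘(ℝ, Model d) j).target,
        ENNReal.ofReal (chartPartition d N i ((extChartAt 𝓘(ℝ, Model d) j).symm y)) *
          (ENNReal.ofReal |ν.density j y| *
            A.indicator 1 ((extChartAt 𝓘(ℝ, Model d) j).symm y)) := by
    intro i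
    have hw : ∀ y, ENNReal.ofReal (chartPartition d N i ((extChartAt 𝓘(ℝ, Model d) i).symm y) *
        |formInChart ν.form i y (stdBasis d)|) =
        ENNReal.ofReal (chartPartition d N i ((extChartAt 𝓘(ℝ, Model d) i).symm y)) *
          ENNReal.ofReal |ν.density i y| := fun y =>
      ENNReal.ofReal_mul ((chartPartition d N).nonneg i _)
    simp only [hw]
    rw [lintegral_map_withDensity_restrict (hTm i) (continuousOn_extChartAt_symm i)
      ((hρ i i).fun_mul (ν.aemeasurable_density i)) (hAm.indicator (hSm j))]
    have key := ν.lintegral_chartTransition i j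
      (fun x => ENNReal.ofReal (chartPartition d N i x) * A.indicator 1 x)
    have e1 : ∫⁻ y in (extChartAt 𝓘(ℝ, Model d) i).target,
        ENNReal.ofReal (chartPartition d N i ((extChartAt 𝓘(ℝ, Model d) i).symm y)) *
          ENNReal.ofReal |ν.density i y| * (extChartAt 𝓘(ℝ, Model d) j).source.indicator
            (A.indicator 1) ((extChartAt 𝓘(ℝ, Model d) i).symm y) =
        ∫⁻ y in (extChartAt 𝓘(ℝ, Model d) i).target ∩ (extChartAt 𝓘(ℝ, Model d) i).symm ⁻¹'
          (extChartAt 𝓘(ℝ, Model d) j).source, ENNReal.ofReal |ν.density i y| *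
            (ENNReal.ofReal (chartPartition d N i ((extChartAt 𝓘(ℝ, Model d) i).symm y)) *
              A.indicator 1 ((extChartAt 𝓘(ℝ, Model d) i).symm y)) := by
      have ho : MeasurableSet ((extChartAt 𝓘(ℝ, Model d) i).target ∩
          (extChartAt 𝓘(ℝ, Model d) i).symm ⁻¹' (extChartAt 𝓘(ℝ, Model d) j).source) :=
        ((continuousOn_extChartAt_symm i).isOpen_inter_preimage
          (isOpen_extChartAt_target i) (isOpen_extChartAt_source j)).measurableSet
      rw [← lintegral_indicator (hTm i), ← lintegral_indicator ho]
      refine lintegral_congr fun y => ?_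
      by_cases h1 : y ∈ (extChartAt 𝓘(ℝ, Model d) i).target
      · by_cases h2 : (extChartAt 𝓘(ℝ, Model d) i).symm y ∈ (extChartAt 𝓘(ℝ, Model d) j).source
        · rw [indicator_of_mem h1, indicator_of_mem (show y ∈ _ ∩ _ from ⟨h1, h2⟩),
            indicator_of_mem h2]
          ring
        · rw [indicator_of_mem h1, indicator_of_notMem h2,
            indicator_of_notMem (show y ∉ _ ∩ _ from fun h => h2 h.2), mul_zero]
      · rw [indicator_of_notMem h1, indicator_of_notMem (fun h => h1 h.1)]
    have e2 : ∫⁻ y in (extChartAt 𝓘(ℝ, Model d) j).target,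
        ENNReal.ofReal (chartPartition d N i ((extChartAt 𝓘(ℝ, Model d) j).symm y)) *
          (ENNReal.ofReal |ν.density j y| *
            A.indicator 1 ((extChartAt 𝓘(ℝ, Model d) j).symm y)) =
        ∫⁻ y in (extChartAt 𝓘(ℝ, Model d) j).target ∩ (extChartAt 𝓘(ℝ, Model d) j).symm ⁻¹'
          (extChartAt 𝓘(ℝ, Model d) i).source, ENNReal.ofReal |ν.density j y| *
            (ENNReal.ofReal (chartPartition d N i ((extChartAt 𝓘(ℝ, Model d) j).symm y)) *
              A.indicator 1 ((extChartAt 𝓘(ℝ, Model d) j).symm y)) := by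
      have ho : MeasurableSet ((extChartAt 𝓘(ℝ, Model d) j).target ∩
          (extChartAt 𝓘(ℝ, Model d) j).symm ⁻¹' (extChartAt 𝓘(ℝ, Model d) i).source) :=
        ((continuousOn_extChartAt_symm j).isOpen_inter_preimage
          (isOpen_extChartAt_target j) (isOpen_extChartAt_source i)).measurableSet
      rw [← lintegral_indicator (hTm j), ← lintegral_indicator ho]
      refine lintegral_congr fun y => ?_
      by_cases h1 : y ∈ (extChartAt 𝓘(ℝ, Model d) j).target
      · by_cases h2 : (extChartAt 𝓘(ℝ, Model d) j).symm y ∈ (extChartAt 𝓘(ℝ, Model d) i).source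
        · rw [indicator_of_mem h1, indicator_of_mem (show y ∈ _ ∩ _ from ⟨h1, h2⟩)]
          ring
        · rw [indicator_of_mem h1,
            indicator_of_notMem (show y ∉ _ ∩ _ from fun h => h2 h.2),
            chartPartition_eq_zero h2, ENNReal.ofReal_zero, zero_mul]
      · rw [indicator_of_notMem h1, indicator_of_notMem (fun h => h1 h.1)]
    rw [e1, e2]
    exact key
  rw [← lintegral_indicator_one hA, ← lintegral_indicator_one hA,
    ← lintegral_indicator (hSm j), VolForm.measure, lintegral_sum_measure,
    tsum_eq_sum (s := partitionIndices d N)]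
  · rw [Finset.sum_congr rfl fun i _ => step i, ← lintegral_finsetSum',
      lintegral_map_withDensity_restrict (hTm j) (continuousOn_extChartAt_symm j)
        (ν.aemeasurable_density j) hAm]
    -- The bump functions add up to one, so the partition of unity disappears.
    · refine lintegral_congr fun y => ?_
      rw [← Finset.sum_mul, ← ENNReal.ofReal_sum_of_nonneg fun i _ =>
        (chartPartition d N).nonneg i _, sum_chartPartition, ENNReal.ofReal_one, one_mul]
    · exact fun i _ => (hρ i j).mul ((ν.aemeasurable_density j).mul
        (hAm.comp_aemeasurable ((continuousOn_extChartAt_symm j).aemeasurable (hTm j))))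
  · intro i hi
    rw [step]
    simp [chartPartition_eq_zero_of_notMem hi]

/-- Allows an integral to be computed in a single chart, without the partition of unity used to
define the measure. -/
theorem VolForm.integral_eq_of_eq_zero (ν : VolForm d N) (j : N) {F : N → ℂ} (hF : Continuous F)
    (h0 : ∀ x ∉ (extChartAt 𝓘(ℝ, Model d) j).source, F x = 0) :
    ∫ x, F x ∂ν.measure = ∫ y in (extChartAt 𝓘(ℝ, Model d) j).target,
      |ν.density j y| • F ((extChartAt 𝓘(ℝ, Model d) j).symm y) := by
  have hg : AEMeasurable (extChartAt 𝓘(ℝ, Model d) j).symm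
      (volume.restrict (extChartAt 𝓘(ℝ, Model d) j).target) :=
    (continuousOn_extChartAt_symm j).aemeasurable (isOpen_extChartAt_target j).measurableSet
  rw [← setIntegral_eq_integral_of_forall_compl_eq_zero h0, ν.restrict_measure j,
    integral_map (hg.mono_ac (withDensity_absolutelyContinuous _ _)) hF.aestronglyMeasurable,
    integral_withDensity_eq_integral_toReal_smul₀ (ν.aemeasurable_density j)
      (Filter.Eventually.of_forall fun _ => ENNReal.ofReal_lt_top)]
  simp [ENNReal.toReal_ofReal]

variable {V : ∀ x : N, TangentSpace 𝓘(ℝ, Model d) x}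

/-- The chart maps the compact support of `f` to a compact subset of its target, and the coordinate
divergence theorem applies with that set as `K`. -/
theorem VolForm.integral_derivAlong_of_tsupport_subset (ν : VolForm d N)
    (hV : ContMDiff 𝓘(ℝ, Model d) (𝓘(ℝ, Model d).prod 𝓘(ℝ, Model d)) ∞
      (fun x => (⟨x, V x⟩ : TangentBundle 𝓘(ℝ, Model d) N))) (j : N) {f : N → ℂ}
    (hf : ContMDiff 𝓘(ℝ, Model d) 𝓘(ℝ, ℂ) 1 f)
    (hs : tsupport f ⊆ (extChartAt 𝓘(ℝ, Model d) j).source) :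
    ∫ x, (derivAlong V f x + (divergence ν V x : ℂ) * f x) ∂ν.measure = 0 := by
  have hc : Continuous fun x => derivAlong V f x + (divergence ν V x : ℂ) * f x :=
    (continuous_derivAlong hf hV).add ((Complex.continuous_ofReal.comp
      (contMDiff_divergence ν hV).continuous).mul hf.continuous)
  have h0 : ∀ x ∉ (extChartAt 𝓘(ℝ, Model d) j).source,
      derivAlong V f x + (divergence ν V x : ℂ) * f x = 0 := by
    intro x hx
    have hx' : f =ᶠ[𝓝 x] fun _ => 0 := notMem_tsupport_iff_eventuallyEq.1 fun h => hx (hs h)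
    have h1 : derivAlong V f x = 0 := by
      unfold derivAlong
      rw [hx'.mfderiv_eq, mfderiv_const]
      rfl
    rw [h1, hx'.self_of_nhds, mul_zero, add_zero]
  rw [ν.integral_eq_of_eq_zero j hc h0]
  have hu : ContDiffOn ℝ 1 (f ∘ (extChartAt 𝓘(ℝ, Model d) j).symm)
      (extChartAt 𝓘(ℝ, Model d) j).target := fun y hy =>
    ((hf _).comp _ ((contMDiffAt_extChartAt_symm_of_mem j
      hy).of_le (by simp))).contDiffAt.contDiffWithinAt
  have hK : IsCompact (extChartAt 𝓘(ℝ, Model d) j '' tsupport f) :=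
    (isClosed_tsupport _).isCompact.image_of_continuousOn ((continuousOn_extChartAt j).mono hs)
  have key := integral_densityDiv_eq_zero (isOpen_extChartAt_target j)
    ((ν.contDiffOn_density j).of_le (by simp)) ((contDiffOn_fieldInChart hV j).of_le (by simp)) hu
    (fun y hy => ν.density_ne_zero j hy) hK
    (by
      rintro _ ⟨x, hx, rfl⟩
      exact (extChartAt 𝓘(ℝ, Model d) j).map_source (hs hx))
    (fun y hy hyK => by
      by_contra hne
      exact hyK ⟨_, subset_tsupport _ hne, (extChartAt 𝓘(ℝ, Model d) j).right_inv hy⟩)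
  rw [← key]
  refine setIntegral_congr_fun (isOpen_extChartAt_target j).measurableSet fun y hy => ?_
  rw [derivAlong_symm V j hy ((hf _).mdifferentiableAt one_ne_zero), divergence_symm ν hV j hy]
  rfl

/-- The divergence theorem on a compact manifold. -/
theorem VolForm.integral_derivAlong_add_divergence (ν : VolForm d N)
    (hV : ContMDiff 𝓘(ℝ, Model d) (𝓘(ℝ, Model d).prod 𝓘(ℝ, Model d)) ∞
      (fun x => (⟨x, V x⟩ : TangentBundle 𝓘(ℝ, Model d) N))) {f : N → ℂ}
    (hf : ContMDiff 𝓘(ℝ, Model d) 𝓘(ℝ, ℂ) 1 f) :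
    ∫ x, (derivAlong V f x + (divergence ν V x : ℂ) * f x) ∂ν.measure = 0 := by
  classical
  -- The function is cut into finitely many pieces, each supported in one chart; the identity is
  -- linear in `f`.
  let ρ : N → N → ℂ := fun i x => (chartPartition d N i x : ℂ) * f x
  have hρ : ∀ i, ContMDiff 𝓘(ℝ, Model d) 𝓘(ℝ, ℂ) 1 (ρ i) := fun i =>
    contMDiff_mul_complex (Complex.ofRealCLM.contDiff.contMDiff.comp
      ((chartPartition d N i).contMDiff.of_le (by simp))) hf
  have hi : ∀ g : N → ℂ, ContMDiff 𝓘(ℝ, Model d) 𝓘(ℝ, ℂ) 1 g →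
      Integrable (fun x => derivAlong V g x + (divergence ν V x : ℂ) * g x) ν.measure := fun g hg =>
    Continuous.integrable_of_hasCompactSupport ((continuous_derivAlong hg hV).add
      ((Complex.continuous_ofReal.comp (contMDiff_divergence ν hV).continuous).mul hg.continuous))
      (HasCompactSupport.of_compactSpace _)
  -- The `C¹` property is carried through the induction because additivity of the derivative and
  -- integrability of the summands depend on it.
  have key : ∀ s : Finset N, ContMDiff 𝓘(ℝ, Model d) 𝓘(ℝ, ℂ) 1 (∑ i ∈ s, ρ i) ∧
      ∫ x, (derivAlong V (∑ i ∈ s, ρ i) x +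
        (divergence ν V x : ℂ) * (∑ i ∈ s, ρ i) x) ∂ν.measure = 0 := by
    intro s
    induction s using Finset.induction_on with
    | empty =>
      refine ⟨contMDiff_const, ?_⟩
      have : ∀ x, derivAlong V (0 : N → ℂ) x = 0 := fun x => by
        unfold derivAlong
        rw [show (0 : N → ℂ) = fun _ => 0 from rfl, mfderiv_const]
        rfl
      simp [this]
    | insert a s ha ih =>
      rw [Finset.sum_insert ha]
      refine ⟨(hρ a).add ih.1, ?_⟩
      have e : ∀ x, derivAlong V (ρ a + ∑ i ∈ s, ρ i) x +
          (divergence ν V x : ℂ) * (ρ a + ∑ i ∈ s, ρ i) x =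
          (derivAlong V (ρ a) x + (divergence ν V x : ℂ) * ρ a x) +
          (derivAlong V (∑ i ∈ s, ρ i) x + (divergence ν V x : ℂ) * (∑ i ∈ s, ρ i) x) := by
        intro x
        rw [derivAlong_add (hρ a) ih.1, Pi.add_apply]
        ring
      simp only [e]
      rw [integral_add (hi _ (hρ a)) (hi _ ih.1), ih.2, add_zero]
      refine ν.integral_derivAlong_of_tsupport_subset hV a (hρ a) ?_
      refine Subset.trans (closure_mono fun x hx => ?_)
        (Subset.trans (chartPartition_subordinate a) (extChartAt_source 𝓘(ℝ, Model d) a).ge)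
      intro h
      exact hx (by simp [ρ, h])
  have hsum : ∑ i ∈ partitionIndices d N, ρ i = f := by
    funext x
    rw [Finset.sum_apply, ← Finset.sum_mul, ← Complex.ofReal_sum, sum_chartPartition,
      Complex.ofReal_one, one_mul]
  have := (key (partitionIndices d N)).2
  rwa [hsum] at this

end Measure

/-! ### Passage to the projective limit -/

namespace ProjFamily

variable {L : Type*} [PartialOrder L] {𝓕 : ProjFamily L}

theorem VolumeForm.integral_measure [IsDirectedOrder L] (μ : 𝓕.VolumeForm) (γ : L) {f : 𝓕.space γ → ℂ}
    (hf : Continuous f) :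
    ∫ A, f (𝓕.limProj γ A) ∂μ.measure = ∫ x, f x ∂(μ.vol γ).measure :=
  μ.exists_measure.choose_spec.2.2 γ f hf

/-- With directedness this brings several cylindrical functions to one common label, where they can
be multiplied and integrated. -/
theorem IsCyl.exists_of_le {F : 𝓕.Limit → ℂ} {γ : L} {n : ℕ∞ω} (hn : n ≤ ∞)
    {f : 𝓕.space γ → ℂ} (hf : ContMDiff 𝓘(ℝ, Model (𝓕.dim γ)) 𝓘(ℝ, ℂ) n f)
    (hF : F = f ∘ 𝓕.limProj γ) {δ : L} (h : γ ≤ δ) :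
    ∃ g : 𝓕.space δ → ℂ, ContMDiff 𝓘(ℝ, Model (𝓕.dim δ)) 𝓘(ℝ, ℂ) n g ∧ F = g ∘ 𝓕.limProj δ :=
  ⟨f ∘ 𝓕.proj h, hf.comp ((𝓕.proj_smooth h).of_le hn), by
    funext A
    simp [hF, proj_limProj]⟩

namespace VectorField

variable {γ₀ : L}

/-- The divergence theorem for the product of the two representatives, expanded by the Leibniz rule.
Compatibility is what lets `div μ X` be represented on the chosen member. -/
theorem integral_mul_deriv [IsDirectedOrder L] {μ : 𝓕.VolumeForm} {X : 𝓕.VectorField γ₀} (hX : X.Compatible μ)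
    {f g : 𝓕.Limit → ℂ} (hf : 𝓕.IsCyl 1 f) (hg : 𝓕.IsCyl 1 g) :
    ∫ A, f A * X.deriv g A ∂μ.measure =
      -∫ A, (X.deriv f A + div μ X A * f A) * g A ∂μ.measure := by
  obtain ⟨γ, f₀, hf₀, hf₁⟩ := hf
  obtain ⟨γ', g₀, hg₀, hg₁⟩ := hg
  -- The label `δ` must dominate those of both functions and the base label of `X`.
  obtain ⟨δ₁, k₁, k₂⟩ := exists_ge_ge γ γ'
  obtain ⟨δ, k₃, h⟩ := exists_ge_ge δ₁ γ₀
  obtain ⟨f', hf', rfl⟩ := IsCyl.exists_of_le (by simp) hf₀ hf₁ (k₁.trans k₃)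
  obtain ⟨g', hg', rfl⟩ := IsCyl.exists_of_le (by simp) hg₀ hg₁ (k₂.trans k₃)
  have e : ∀ p : 𝓕.space δ → ℂ, X.derivMember δ h p = derivAlong (X.field δ h) p := fun _ => rfl
  rw [X.deriv_comp_limProj h hf', X.deriv_comp_limProj h hg', e, e]
  simp only [div_eq hX h, Function.comp_apply]
  have cX := X.smooth δ h
  have cf := continuous_derivAlong hf' cX
  have cg := continuous_derivAlong hg' cX
  have cd : Continuous fun x => (divergence (μ.vol δ) (X.field δ h) x : ℂ) :=
    Complex.continuous_ofReal.comp (contMDiff_divergence (μ.vol δ) cX).continuous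
  have c₁ : Continuous fun x => f' x * derivAlong (X.field δ h) g' x := hf'.continuous.mul cg
  have c₂ : Continuous fun x => (derivAlong (X.field δ h) f' x +
      (divergence (μ.vol δ) (X.field δ h) x : ℂ) * f' x) * g' x :=
    (cf.add (cd.mul hf'.continuous)).mul hg'.continuous
  rw [μ.integral_measure δ c₁, μ.integral_measure δ c₂, eq_neg_iff_add_eq_zero, ← integral_add
    (c₁.integrable_of_hasCompactSupport (HasCompactSupport.of_compactSpace _))
    (c₂.integrable_of_hasCompactSupport (HasCompactSupport.of_compactSpace _)),
    ← (μ.vol δ).integral_derivAlong_add_divergence cX (contMDiff_mul_complex hf' hg')]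
  refine integral_congr_ae (Filter.Eventually.of_forall fun x => ?_)
  simp only [derivAlong_mul hf' hg', Pi.mul_apply]
  ring

/-- Compatibility of `Y` makes its divergence on the larger member a pull-back, and the members of
`X` are related by the projection, so the chain rule applies. -/
theorem derivAlong_divergence_proj {γ₁ γ₂ : L} {μ : 𝓕.VolumeForm} (X : 𝓕.VectorField γ₁)
    {Y : 𝓕.VectorField γ₂} (hY : Y.Compatible μ) {γ γ' : L} (h₁ : γ₁ ≤ γ) (h₂ : γ₂ ≤ γ)
    (h' : γ ≤ γ') (x : 𝓕.space γ') :
    derivAlong (X.field γ h₁) (divergence (μ.vol γ) (Y.field γ h₂)) (𝓕.proj h' x) =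
      derivAlong (X.field γ' (h₁.trans h'))
        (divergence (μ.vol γ') (Y.field γ' (h₂.trans h'))) x := by
  have e : divergence (μ.vol γ') (Y.field γ' (h₂.trans h')) =
      divergence (μ.vol γ) (Y.field γ h₂) ∘ 𝓕.proj h' := funext fun z => (hY γ γ' h₂ h' z).symm
  rw [e]
  unfold derivAlong
  rw [mfderiv_comp x ((contMDiff_divergence _ (Y.smooth γ h₂) _).mdifferentiableAt (by simp))
    ((𝓕.proj_smooth h' x).mdifferentiableAt (by simp)), ← X.consistent γ γ' h₁ h' x]
  rfl

theorem divergence_bracket {γ₁ γ₂ γ₃ : L} (μ : 𝓕.VolumeForm) (X : 𝓕.VectorField γ₁)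
    (Y : 𝓕.VectorField γ₂) (h₁ : γ₁ ≤ γ₃) (h₂ : γ₂ ≤ γ₃) {γ : L} (h : γ₃ ≤ γ) (x : 𝓕.space γ) :
    divergence (μ.vol γ) ((X.bracket Y h₁ h₂).field γ h) x =
      derivAlong (X.field γ (h₁.trans h)) (divergence (μ.vol γ) (Y.field γ (h₂.trans h))) x -
        derivAlong (Y.field γ (h₂.trans h)) (divergence (μ.vol γ) (X.field γ (h₁.trans h))) x :=
  divergence_mlieBracket (μ.vol γ) (X.smooth γ _) (Y.smooth γ _)
    ((X.bracket Y h₁ h₂).smooth γ h) x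

/-- The divergence of the bracket is a difference of two terms, each of which pulls back correctly
by `derivAlong_divergence_proj`. -/
theorem Compatible.bracket {γ₁ γ₂ γ₃ : L} {μ : 𝓕.VolumeForm} {X : 𝓕.VectorField γ₁}
    {Y : 𝓕.VectorField γ₂} (hX : X.Compatible μ) (hY : Y.Compatible μ) (h₁ : γ₁ ≤ γ₃)
    (h₂ : γ₂ ≤ γ₃) : (X.bracket Y h₁ h₂).Compatible μ := fun γ γ' h h' x => by
  rw [divergence_bracket, divergence_bracket, derivAlong_divergence_proj X hY,
    derivAlong_divergence_proj Y hX]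

/-- Moves the outer derivation to any member above both base labels. The divergence there is real
valued while `deriv` acts on complex functions, and the coercion is linear, so it commutes with
differentiation. -/
theorem deriv_div_apply [IsDirectedOrder L] {γ₁ γ₂ : L} {μ : 𝓕.VolumeForm} (X : 𝓕.VectorField γ₁)
    {Y : 𝓕.VectorField γ₂} (hY : Y.Compatible μ) {γ : L} (h₁ : γ₁ ≤ γ) (h₂ : γ₂ ≤ γ)
    (A : 𝓕.Limit) :
    X.deriv (div μ Y) A =
      Complex.ofReal
        (derivAlong (X.field γ h₁) (divergence (μ.vol γ) (Y.field γ h₂)) (𝓕.limProj γ A)) := by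
  have e : div μ Y = (Complex.ofRealCLM ∘ divergence (μ.vol γ) (Y.field γ h₂)) ∘ 𝓕.limProj γ :=
    funext fun B => div_eq hY h₂ B
  have hd := contMDiff_divergence (μ.vol γ) (Y.smooth γ h₂)
  rw [e, X.deriv_comp_limProj h₁
    (Complex.ofRealCLM.contDiff.contMDiff.comp (hd.of_le (by simp)))]
  simp only [Function.comp_apply]
  unfold derivMember derivAlong
  rw [mfderiv_comp (I' := 𝓘(ℝ, ℝ)) _ Complex.ofRealCLM.mdifferentiableAt
    ((hd _).mdifferentiableAt (by simp)), Complex.ofRealCLM.mfderiv_eq]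
  rfl

end VectorField
end ProjFamily
end ProjGeom

end

theorem proposition7 {L : Type*} [PartialOrder L] [IsDirectedOrder L] (𝓕 : ProjGeom.ProjFamily L)
    (μ : 𝓕.VolumeForm) {γ₁ : L} (X : 𝓕.VectorField γ₁) (hX : X.Compatible μ) :
    (∀ f g : 𝓕.Limit → ℂ, 𝓕.IsCyl 1 f → 𝓕.IsCyl 1 g →
      ∫ A, f A * X.deriv g A ∂μ.measure =
        -∫ A, (X.deriv f A + ProjGeom.ProjFamily.VectorField.div μ X A * f A) * g A ∂μ.measure) ∧
    (∀ (γ₂ : L) (Y : 𝓕.VectorField γ₂), Y.Compatible μ →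
      ∀ (γ₃ : L) (h₁ : γ₁ ≤ γ₃) (h₂ : γ₂ ≤ γ₃),
        (X.bracket Y h₁ h₂).Compatible μ ∧
        ProjGeom.ProjFamily.VectorField.div μ (X.bracket Y h₁ h₂) =
          X.deriv (ProjGeom.ProjFamily.VectorField.div μ Y) - Y.deriv (ProjGeom.ProjFamily.VectorField.div μ X)) := by
  refine ⟨fun f g hf hg => ProjGeom.ProjFamily.VectorField.integral_mul_deriv hX hf hg,
    fun γ₂ Y hY γ₃ h₁ h₂ => ⟨hX.bracket hY h₁ h₂, funext fun A => ?_⟩⟩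
  -- All three terms are evaluated on the member `γ₃`, the base label at which `div` of the bracket
  -- is defined.
  rw [Pi.sub_apply, X.deriv_div_apply hY h₁ h₂, Y.deriv_div_apply hX h₂ h₁,
    ProjGeom.ProjFamily.VectorField.div, ProjGeom.ProjFamily.VectorField.divergence_bracket,
    Complex.ofReal_sub]
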